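/- Let $k,n\ge 0$, let $Q$ be a smooth manifold of dimension $n$, and let $T^1_kQ$ and $(T^1_k)^*Q$ be the Whitney sums of $k$ copies of $TQ$ and of $T^*Q$, with projections $\tau_Q,\tau_Q^*$ to $Q$. On $(T^1_k)^*Q$ let $(\omega_0)_A=-d(\theta_0)_A$, where $(\theta_0)_A(\alpha)(X)=\alpha^A((\tau_Q^*)_*X)$, $1\le A\le k$. Let $L\colon T^1_kQ\to\mathbb R$ be smooth. Let $S^A$ be the canonical $k$-tangent structure ($S^A=\partial/\partial v^i_A\otimes dq^i$ in natural coordinates $(q^i,v^i_A)$) and $C=v^i_A\,\partial/\partial v^i_A$ the Liouville vector field, and put $(\omega_L)_A=-d(dL\circ S^A)$, $E_L=C(L)-L$. The Legendre map $FL\colon T^1_kQ\to (T^1_k)^*Q$ is $[FL(v_1,\dots,v_k)]^A(w)=\frac{d}{ds}\big|_{s=0}L(v_1,\dots,v_A+sw,\dots,v_k)$, and $L$ is regular if $\det(\partial^2L/\partial v^i_A\partial v^j_B)\ne0$ everywhere. On $W=T^1_kQ\oplus_Q(T^1_k)^*Q$ with projections $pr_1,pr_2$ let $\Omega_A=pr_2^*(\omega_0)_A$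 and $\mathcal H(v,\alpha)=\sum_A\alpha^A(v_A)-L(v)$. Let $\jmath\colon M_L\hookrightarrow W$ be the graph of $FL$, an embedded submanifold, and $pr_1^0=pr_1\circ\jmath\colon M_L\to T^1_kQ$, which is a diffeomorphism. A $k$-vector field $X=(X_1,\dots,X_k)$ on a manifold $M$ is a $k$-tuple of smooth vector fields. It is integrable if for each $x\in M$ there is a smooth map $\phi\colon U\to M$ on an open neighbourhood $U$ of $0\in\mathbb R^k$ with $\phi(0)=x$ and $\phi_*(t)(\partial/\partial t^A)=X_A(\phi(t))$ for all $t\in U$ and all $A$. On $M=T^1_kQ$ it is a SOPDE if $(\tau_Q)_*(X_A(v))=v_A$ for all $v=(v_1,\dots,v_k)$ and all $A$, and holonomic if it is an integrable SOPDE. For a $k$-vector field $Z$ on $M_L$ let $X_L=T^1_k(pr_1^0)\circ Z\circ(pr_1^0)^{-1}$, i.e. $(X_L)_A=(pr^0_1)_*Z_A$. We say that $Z$ solves the unified equation if $$\sum_{A=1}^k i_{\jmath_*Z_A}\Omega_A=d\mathcal H\qquad(1)$$ as covectors of $W$ at every point of $M_L$, and that a $k$-vector field $X$ on $T^1_kQ$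 solves the Lagrangian equation if $$\sum_{A=1}^k i_{X_A}(\omega_L)_A=dE_L.\qquad(2)$$ 1. If $Z$ solves (1), then $X_L$ is a $k$-vector field on $T^1_kQ$ solving (2). 2. Conversely, if $L$ is regular, then every $k$-vector field $X$ solving (2) is $X_L$ for some $k$-vector field $Z$ on $M_L$ solving (1). For arbitrary $L$ this holds for every $X$ solving (2) that is a SOPDE. 3. If $Z$ solves (1), then $Z$ is integrable if and only if $X_L$ is holonomic. 4. For arbitrary $L$, a $k$-vector field $Z$ on $M_L$ solves the pulled-back equation $\sum_A i_{Z_A}\jmath^*\Omega_A=d(\jmath^*\mathcal H)$ if and only if $X_L$ solves (2), and every $k$-vector field $X$ solving (2) is $X_L$ for some $Z$ solving the pulled-back equation. If $L$ is regular, the pulled-back equation is equivalent to (1) for every $k$-vector field $Z$ on $M_L$. -/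

import Mathlib

open Bundle Set Topology
open scoped Manifold ContDiff

noncomputable section

namespace KSymplectic

section Manifold

variable {E H M : Type*} [NormedAddCommGroup E] [NormedSpace ℝ E] [TopologicalSpace H]
  (J : ModelWithCorners ℝ E H) [TopologicalSpace M] [ChartedSpace H M]

/-- The differential `df` of a real function `f`. -/
def differential (f : M → ℝ) (p : M) : TangentSpace J p →L[ℝ] ℝ := mfderiv J 𝓘(ℝ) f p

/-- The exterior derivative `dθ (u, v)` of a one-form `θ` on a manifold without boundary, at the point
`p`: the exterior derivative of the local representative of `θ` in the chart at `p`, evaluated on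
the representatives of `u` and `v`. Convention: `dθ (U, V) = U (θ V) - V (θ U) - θ [U, V]`. -/
def extDerivOneForm (θ : ∀ p : M, TangentSpace J p →L[ℝ] ℝ) (p : M)
    (u v : TangentSpace J p) : ℝ :=
  extDeriv (fun y : E =>
      ContinuousAlternatingMap.ofSubsingleton ℝ E ℝ (0 : Fin 1)
        ((θ ((extChartAt J p).symm y)).comp (mfderiv 𝓘(ℝ, E) J (extChartAt J p).symm y)))
    (extChartAt J p p)
    ![mfderiv J 𝓘(ℝ, E) (extChartAt J p) p u, mfderiv J 𝓘(ℝ, E) (extChartAt J p) p v]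

/-- A family `X = (X_1, …, X_k)` of pointwise tangent vectors is a `k`-vector field on `M`: each
`X_A` is a smooth vector field (equivalently, `X` is a smooth section of `T¹ₖM → M`). -/
def IsKVectorField [IsManifold J ∞ M] {k : ℕ} (X : Fin k → ∀ p : M, TangentSpace J p) : Prop :=
  ∀ A, ContMDiff J J.tangent ∞ (fun p : M => (⟨p, X A p⟩ : TangentBundle J M))

/-- `φ : U → M` is an integral section of `X`, with `U` an open neighbourhood of `0` in `ℝᵏ`:
`φ_* (t) (∂/∂t^A) = X_A (φ t)` for all `t ∈ U` and all `A`. -/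
def IsIntegralSection {k : ℕ} (X : Fin k → ∀ p : M, TangentSpace J p)
    (U : Set (Fin k → ℝ)) (φ : (Fin k → ℝ) → M) : Prop :=
  IsOpen U ∧ 0 ∈ U ∧ ContMDiffOn 𝓘(ℝ, Fin k → ℝ) J ∞ φ U ∧
    ∀ t ∈ U, ∀ A, mfderiv 𝓘(ℝ, Fin k → ℝ) J φ t (Pi.single A 1 : Fin k → ℝ) = X A (φ t)

/-- `X` is integrable: through each point of `M` passes an integral section of `X`. -/
def IsIntegrable {k : ℕ} (X : Fin k → ∀ p : M, TangentSpace J p) : Prop :=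
  ∀ p : M, ∃ U φ, IsIntegralSection J X U φ ∧ φ 0 = p

end Manifold

section Transport

variable {H M N : Type*} [TopologicalSpace H] [TopologicalSpace M] [TopologicalSpace N]
  [ChartedSpace H N]

/-- The manifold structure on `M` for which the homeomorphism `e : M ≃ₜ N` onto a manifold is a
diffeomorphism: the charts are `c ∘ e` for `c` a chart of `N`. -/
@[reducible]
def pullbackChartedSpace (e : M ≃ₜ N) : ChartedSpace H M where
  atlas := {c' | ∃ c ∈ atlas H N, c' = e.toOpenPartialHomeomorph.trans c}
  chartAt m := e.toOpenPartialHomeomorph.trans (chartAt H (e m))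
  mem_chart_source m := by simp
  chart_mem_atlas m := ⟨_, chart_mem_atlas H (e m), rfl⟩

theorem pullbackChartedSpace_isManifold {E : Type*} [NormedAddCommGroup E] [NormedSpace ℝ E]
    (J : ModelWithCorners ℝ E H) [IsManifold J ∞ N] (e : M ≃ₜ N) :
    @IsManifold ℝ _ E _ _ H _ J ∞ M _ (pullbackChartedSpace e) := by
  let _ : ChartedSpace H M := pullbackChartedSpace e
  refine { compatible := ?_ }
  rintro _ _ ⟨c, hc, rfl⟩ ⟨c', hc', rfl⟩
  have h := (contDiffGroupoid ∞ J).compatible hc hc'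
  have : ((e.toOpenPartialHomeomorph.trans c).symm.trans
      (e.toOpenPartialHomeomorph.trans c')) = c.symm.trans c' := by
    ext x <;> simp
  rwa [this]

end Transport

section Bundles

variable (k n : ℕ) (Q : Type*) [TopologicalSpace Q] [ChartedSpace (EuclideanSpace ℝ (Fin n)) Q]

/-- Model fibre of the tangent bundle of `k¹`-velocities. -/
abbrev VelModel (k n : ℕ) : Type := (Fin k → ℝ) →L[ℝ] EuclideanSpace ℝ (Fin n)
/-- Model fibre of the cotangent bundle of `k¹`-covelocities. -/
abbrev CovelModel (k n : ℕ) : Type := EuclideanSpace ℝ (Fin n) →L[ℝ] (Fin k → ℝ)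

/-- The fibre `T_qQ ⊕ ⋯ ⊕ T_qQ` (`k` copies) of `T¹ₖQ`, as linear maps `ℝᵏ → T_qQ` (1-jets at `0` of
maps `ℝᵏ → Q` with value `q`); the tuple `(v_1, …, v_k)` is the linear map `r_A ↦ v_A`. -/
abbrev VelFiber (q : Q) : Type := Bundle.Trivial Q (Fin k → ℝ) q →L[ℝ] TangentSpace (𝓡 n) q
/-- The fibre `T*_qQ ⊕ ⋯ ⊕ T*_qQ` (`k` copies) of `(T¹ₖ)*Q`, as linear maps `T_qQ → ℝᵏ` (1-jets at `q`
of maps `Q → ℝᵏ` with value `0`); `α^A` is the `A`-th component. -/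
abbrev CovelFiber (q : Q) : Type := TangentSpace (𝓡 n) q →L[ℝ] Bundle.Trivial Q (Fin k → ℝ) q

/-- The tangent bundle of `k¹`-velocities `T¹ₖQ`. -/
abbrev Vel : Type _ := TotalSpace (VelModel k n) (VelFiber k n Q)
/-- The cotangent bundle of `k¹`-covelocities `(T¹ₖ)*Q`. -/
abbrev Covel : Type _ := TotalSpace (CovelModel k n) (CovelFiber k n Q)
/-- The Whitney sum `T¹ₖQ ⊕_Q (T¹ₖ)*Q`. -/
abbrev VelCovel : Type _ :=
  TotalSpace (VelModel k n × CovelModel k n) (VelFiber k n Q ×ᵇ CovelFiber k n Q)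

/-- Models (with corners, but without boundary) of the three manifolds. -/
abbrev IVel := (𝓡 n).prod 𝓘(ℝ, VelModel k n)
abbrev ICovel := (𝓡 n).prod 𝓘(ℝ, CovelModel k n)
abbrev IVelCovel := (𝓡 n).prod 𝓘(ℝ, VelModel k n × CovelModel k n)

/-- A smooth Lagrangian function `L : T¹ₖQ → ℝ`. -/
abbrev Lagrangian [IsManifold (𝓡 n) ∞ Q] : Type _ := C^∞⟮IVel k n, Vel k n Q; 𝓘(ℝ), ℝ⟯

end Bundles

variable {k n : ℕ} {Q : Type*} [TopologicalSpace Q] [ChartedSpace (EuclideanSpace ℝ (Fin n)) Q]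
  [IsManifold (𝓡 n) ∞ Q]

/-- The tuple `(0, …, X, …, 0)` with `X` in the `A`-th place, that is, `r_B ↦ δ_{AB} X`. -/
def coordIncl (A : Fin k) : EuclideanSpace ℝ (Fin n) →L[ℝ] VelModel k n :=
  ContinuousLinearMap.smulRightL ℝ (Fin k → ℝ) (EuclideanSpace ℝ (Fin n))
    (ContinuousLinearMap.proj A)

/-- The inclusion of the fibre over `q` in `T¹ₖQ`. -/
def fiberIncl (q : Q) (u : VelModel k n) : Vel k n Q := ⟨q, u⟩

/-- The vertical lift at `v`: the tuple `u` over the base point of `v` goes to the velocity at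
`s = 0` of the curve `v + s u` in the fibre. The vertical `A`-lift of a tangent vector `X` of `Q` is
`verticalLift v (coordIncl A X)`. -/
def verticalLift (v : Vel k n Q) : VelModel k n →L[ℝ] TangentSpace (IVel k n) v :=
  mfderiv 𝓘(ℝ, VelModel k n) (IVel k n) (fiberIncl v.proj) v.snd

/-- The canonical `k`-tangent structure: `S^A (v) (Z)` is the vertical `A`-lift at `v` of
`(τ_Q)_* (v) (Z)`. -/
def kTangentStructure (A : Fin k) (v : Vel k n Q) :
    TangentSpace (IVel k n) v →L[ℝ] TangentSpace (IVel k n) v :=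
  (verticalLift v).comp ((coordIncl A).comp
    (mfderiv (IVel k n) (𝓡 n) (TotalSpace.proj : Vel k n Q → Q) v))

/-- The Liouville vector field `C`, generator of the flow `(s, v) ↦ e^s v`. -/
def liouville (v : Vel k n Q) : TangentSpace (IVel k n) v :=
  mfderiv 𝓘(ℝ) (IVel k n) (fun s : ℝ => fiberIncl v.proj (Real.exp s • v.snd)) 0 (1 : ℝ)

variable (L : Lagrangian k n Q)

/-- The one-forms `(θ_L)_A = dL ∘ S^A`. -/
def thetaL (A : Fin k) (v : Vel k n Q) : TangentSpace (IVel k n) v →L[ℝ] ℝ :=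
  (differential (IVel k n) L v).comp (kTangentStructure A v)

/-- The two-forms `(ω_L)_A = -d(θ_L)_A`. -/
def omegaL (A : Fin k) (v : Vel k n Q) (X Y : TangentSpace (IVel k n) v) : ℝ :=
  -extDerivOneForm (IVel k n) (thetaL L A) v X Y

/-- The energy `E_L = C(L) - L`. -/
def energy (v : Vel k n Q) : ℝ :=
  differential (IVel k n) L v (liouville v) - L v

/-- The Lagrangian `k`-symplectic equation `∑_A i_{X_A} (ω_L)_A = dE_L` on `T¹ₖQ`. -/
def SolvesLagrangian (X : Fin k → ∀ v : Vel k n Q, TangentSpace (IVel k n) v) : Prop :=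
  ∀ (v : Vel k n Q) (Y : TangentSpace (IVel k n) v),
    ∑ A, omegaL L A v (X A v) Y = differential (IVel k n) (energy L) v Y

/-- `L` is regular: `det (∂²L / ∂v^i_A ∂v^j_B) ≠ 0` everywhere on `T¹ₖQ`. The coordinates used on the
fibre over `q` are those induced by the chart at `q`, for which `T_qQ` is `ℝⁿ` with its standard
basis. -/
def IsRegularLagrangian : Prop :=
  ∀ v : Vel k n Q, (Matrix.of fun a b : Fin n × Fin k =>
    fderiv ℝ (fderiv ℝ (fun u : VelModel k n => L (fiberIncl v.proj u))) v.snd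
      (coordIncl a.2 (EuclideanSpace.single a.1 1)) 
      (coordIncl b.2 (EuclideanSpace.single b.1 1))).det ≠ 0

/-- `X` is a second order partial differential equation: `T¹ₖ(τ_Q) ∘ X = id`, that is,
`(τ_Q)_* (X_A (v)) = v_A`. -/
def IsSopde (X : Fin k → ∀ v : Vel k n Q, TangentSpace (IVel k n) v) : Prop :=
  ∀ A (v : Vel k n Q), mfderiv (IVel k n) (𝓡 n) (TotalSpace.proj : Vel k n Q → Q) v (X A v) =
    v.snd (Pi.single A 1 : Fin k → ℝ)

/-- `X` is holonomic: it is an integrable second order partial differential equation. -/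
def IsHolonomic (X : Fin k → ∀ v : Vel k n Q, TangentSpace (IVel k n) v) : Prop :=
  IsSopde X ∧ IsIntegrable (IVel k n) X

/-- The one-forms `(θ_0)_A = (τ*_A)^* θ_0` on `(T¹ₖ)*Q`, with `θ_0` the Liouville form of `T*Q`:
`(θ_0)_A (α) (X) = α^A ((τ*_Q)_* (α) (X))`. -/
def theta0 (A : Fin k) (α : Covel k n Q) : TangentSpace (ICovel k n) α →L[ℝ] ℝ :=
  (ContinuousLinearMap.proj A : (Fin k → ℝ) →L[ℝ] ℝ).comp ((α.snd : CovelModel k n).comp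
    (mfderiv (ICovel k n) (𝓡 n) (TotalSpace.proj : Covel k n Q → Q) α))

/-- The canonical two-forms `(ω_0)_A = -d(θ_0)_A` on `(T¹ₖ)*Q`. -/
def omega0 (A : Fin k) (α : Covel k n Q) (X Y : TangentSpace (ICovel k n) α) : ℝ :=
  -extDerivOneForm (ICovel k n) (theta0 A) α X Y

/-- The projection of the Whitney sum to `T¹ₖQ`. -/
def pr1 (w : VelCovel k n Q) : Vel k n Q := ⟨w.proj, w.snd.1⟩
/-- The projection of the Whitney sum to `(T¹ₖ)*Q`. -/
def pr2 (w : VelCovel k n Q) : Covel k n Q := ⟨w.proj, w.snd.2⟩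

/-- The two-forms `Ω_A = pr₂^* (ω_0)_A` on the Whitney sum. -/
def Omega (A : Fin k) (w : VelCovel k n Q) (X Y : TangentSpace (IVelCovel k n) w) : ℝ :=
  omega0 A (pr2 w) (mfderiv (IVelCovel k n) (ICovel k n) pr2 w X)
    (mfderiv (IVelCovel k n) (ICovel k n) pr2 w Y)

/-- The coupling function `∑_A α^A (v_A)`. -/
def coupling (w : VelCovel k n Q) : ℝ :=
  ∑ A, (w.snd.2 (w.snd.1 (Pi.single A 1 : Fin k → ℝ)) : Fin k → ℝ) A

/-- The Hamiltonian function `pairing - pr₁^* L` on the Whitney sum. -/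
def hamiltonian (w : VelCovel k n Q) : ℝ := coupling w - L (pr1 w)

/-- The Legendre map: `[FL (v)]^A (X)` is the derivative at `s = 0` of
`L (v_1, …, v_A + s X, …, v_k)`. -/
def legendre (v : Vel k n Q) : Covel k n Q :=
  ⟨v.proj, ContinuousLinearMap.pi fun A =>
    (fderiv ℝ (fun u : VelModel k n => L (fiberIncl v.proj u)) v.snd).comp (coordIncl A)⟩

theorem extChartAt_vel (v₀ v : Vel k n Q) :
    extChartAt (IVel k n) v₀ v = (extChartAt (𝓡 n) v₀.proj v.proj,
      (((trivializationAt (EuclideanSpace ℝ (Fin n)) (TangentSpace (𝓡 n)) v₀.proj).continuousLinearMapAt ℝ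
        v.proj).comp (v.snd : VelModel k n) : VelModel k n)) := by
  rw [FiberBundle.extChartAt]
  simp only [PartialEquiv.coe_trans, PartialEquiv.prod_coe, Function.comp_apply,
    PartialEquiv.refl_coe, id, OpenPartialHomeomorph.coe_toPartialEquiv, Trivialization.coe_coe]
  rw [hom_trivializationAt_apply]
  refine Prod.ext rfl ?_
  ext w i
  simp [ContinuousLinearMap.inCoordinates]

theorem contMDiff_legendre : ContMDiff (IVel k n) (ICovel k n) ∞ (legendre L) := by
  intro v₀
  rw [contMDiffAt_hom_bundle]
  refine ⟨contMDiffAt_proj _, ?_⟩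
  set T := trivializationAt (EuclideanSpace ℝ (Fin n)) (TangentSpace (𝓡 n)) v₀.proj with hT
  let G : EuclideanSpace ℝ (Fin n) × VelModel k n → ℝ := fun y => L ((extChartAt (IVel k n) v₀).symm y)
  have hopen : IsOpen (extChartAt (IVel k n) v₀).target := isOpen_extChartAt_target v₀
  have hG : ContDiffOn ℝ ∞ G (extChartAt (IVel k n) v₀).target := by
    rw [← contMDiffOn_iff_contDiffOn]
    exact L.contMDiff.comp_contMDiffOn (contMDiffOn_extChartAt_symm v₀)
  let K : EuclideanSpace ℝ (Fin n) × VelModel k n → CovelModel k n := fun y =>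
    ContinuousLinearMap.pi fun A => (fderiv ℝ G y).comp
      ((ContinuousLinearMap.inr ℝ _ _).comp (coordIncl A))
  have hK : ContDiffOn ℝ ∞ K (extChartAt (IVel k n) v₀).target := by
    rw [contDiffOn_clm_apply]
    intro w
    rw [contDiffOn_pi]
    intro A
    exact (hG.fderiv_of_isOpen hopen (m := ∞) (by simp)).clm_apply contDiffOn_const
  have hKv : ContMDiffAt (IVel k n) 𝓘(ℝ, CovelModel k n) ∞
      (fun v => K (extChartAt (IVel k n) v₀ v)) v₀ := by
    have h1 := hK.contDiffAt (hopen.mem_nhds (mem_extChartAt_target v₀))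
    exact h1.contMDiffAt.comp v₀ contMDiffAt_extChartAt
  refine hKv.congr_of_eventuallyEq ?_
  filter_upwards [(extChartAt_source_mem_nhds (I := IVel k n) v₀)] with v hv
  have hb : v.proj ∈ T.baseSet := by
    rw [FiberBundle.extChartAt] at hv
    simpa [hT] using hv.1
  have key : ∀ u : VelModel k n, L (fiberIncl v.proj u) =
      G (extChartAt (𝓡 n) v₀.proj v.proj, (T.continuousLinearMapAt ℝ v.proj).comp u) := by
    intro u
    have hu : fiberIncl v.proj u ∈ (extChartAt (IVel k n) v₀).source := by
      rw [FiberBundle.extChartAt] at hv ⊢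
      exact ⟨hv.1, hv.2⟩
    have h := (extChartAt (IVel k n) v₀).left_inv hu
    rw [extChartAt_vel] at h
    exact congrArg L h.symm
  have hGd : DifferentiableAt ℝ G (extChartAt (𝓡 n) v₀.proj v.proj,
      (T.continuousLinearMapAt ℝ v.proj).comp (v.snd : VelModel k n)) := by
    have h1 := (extChartAt (IVel k n) v₀).map_source hv
    have h2 := (hG.contDiffAt (hopen.mem_nhds h1)).differentiableAt (by simp)
    rwa [extChartAt_vel] at h2
  let a : VelModel k n →L[ℝ] VelModel k n :=
    ContinuousLinearMap.compL ℝ (Fin k → ℝ) (EuclideanSpace ℝ (Fin n)) (EuclideanSpace ℝ (Fin n))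
      (T.continuousLinearMapAt ℝ v.proj)
  have hd : fderiv ℝ (fun u : VelModel k n => L (fiberIncl v.proj u)) v.snd =
      (fderiv ℝ G (extChartAt (IVel k n) v₀ v)).comp ((ContinuousLinearMap.inr ℝ _ _).comp a) := by
    rw [extChartAt_vel]
    generalize hx : (v.snd : VelModel k n) = x at hGd ⊢
    have h1 : HasFDerivAt (fun u : VelModel k n => (extChartAt (𝓡 n) v₀.proj v.proj, a u))
        ((ContinuousLinearMap.inr ℝ _ _).comp a) x :=
      (hasFDerivAt_const (extChartAt (𝓡 n) v₀.proj v.proj) x).prodMk a.hasFDerivAt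
    have h2 := HasFDerivAt.comp x (f := fun u => (extChartAt (𝓡 n) v₀.proj v.proj, a u))
      hGd.hasFDerivAt h1
    have h3 : (fun u : VelModel k n => L (fiberIncl v.proj u)) =
      G ∘ fun u => (extChartAt (𝓡 n) v₀.proj v.proj, a u) := funext key
    rw [h3]
    exact h2.fderiv
  ext w A
  have e1 : a (coordIncl A (T.symmL ℝ v.proj w)) = coordIncl A w := by
    refine ContinuousLinearMap.ext fun t => ?_
    change T.continuousLinearMapAt ℝ v.proj (t A • T.symmL ℝ v.proj w) = t A • w
    rw [map_smul, T.continuousLinearMapAt_symmL hb]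
  have e2 : Trivialization.continuousLinearMapAt ℝ
      (trivializationAt (Fin k → ℝ) (Trivial Q (Fin k → ℝ)) v₀.proj) v.proj =
      ContinuousLinearMap.id ℝ (Fin k → ℝ) :=
    Bundle.Trivial.continuousLinearMapAt_trivialization ℝ Q (Fin k → ℝ) v.proj
  simp only [ContinuousLinearMap.inCoordinates, legendre, K, ContinuousLinearMap.comp_apply]
  rw [e2]
  change fderiv ℝ (fun u : VelModel k n => L (fiberIncl v.proj u)) v.snd
      (coordIncl A (T.symmL ℝ v.proj w)) =
    fderiv ℝ G (extChartAt (IVel k n) v₀ v) (ContinuousLinearMap.inr ℝ _ _ (coordIncl A w))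
  rw [hd, ← e1]
  rfl

/-- The submanifold `M_L` of the Whitney sum: the graph of the Legendre map. -/
def ML : Set (VelCovel k n Q) := {w | pr2 w = legendre L (pr1 w)}

/-- The restricted projection `pr₁⁰ : M_L → T¹ₖQ`, a homeomorphism with inverse `v ↦ (v, FL v)`. -/
def pr1ML : ML L ≃ₜ Vel k n Q where
  toFun m := pr1 m.1
  invFun v := ⟨⟨v.proj, (v.snd, (legendre L v).snd)⟩, rfl⟩
  left_inv := by
    rintro ⟨⟨q, u, α⟩, h⟩
    refine Subtype.ext ?_
    have h1 : (⟨q, α⟩ : Covel k n Q) = ⟨q, (legendre L ⟨q, u⟩).snd⟩ := h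
    have h2 : α = (legendre L ⟨q, u⟩).snd := by
      injection h1
    simp only [pr1, h2]
  right_inv v := rfl
  continuous_toFun := by
    have h := (FiberBundle.Prod.isInducing_diag (VelModel k n) (VelFiber k n Q)
      (CovelModel k n) (CovelFiber k n Q)).continuous
    exact (continuous_fst.comp h).comp continuous_subtype_val
  continuous_invFun := by
    refine Continuous.subtype_mk ?_ _
    rw [(FiberBundle.Prod.isInducing_diag (VelModel k n) (VelFiber k n Q)
      (CovelModel k n) (CovelFiber k n Q)).continuous_iff]
    exact continuous_id.prodMk (contMDiff_legendre L).continuous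

/-- As the graph of a smooth map, `M_L` is an embedded submanifold of the Whitney sum; its
submanifold structure is the one for which `pr₁⁰` is a diffeomorphism. -/
instance : ChartedSpace (ModelProd (EuclideanSpace ℝ (Fin n)) (VelModel k n)) (ML L) :=
  pullbackChartedSpace (pr1ML L)

instance : IsManifold (IVel k n) ∞ (ML L) :=
  pullbackChartedSpace_isManifold (IVel k n) (pr1ML L)

/-- The inclusion `j` of `M_L` in the Whitney sum. -/
def inclML (m : ML L) : VelCovel k n Q := m.1

/-- A `k`-vector field `Z` on `M_L` solves the unified equation `∑_A i_{Z_A} Ω_A = dH`: the equation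
holds at each point of `M_L` as an identity of covectors of the Whitney sum (tested on all of its
tangent vectors `Y`, tangent to `M_L` or not). -/
def SolvesUnified (Z : Fin k → ∀ m : ML L, TangentSpace (IVel k n) m) : Prop :=
  ∀ (m : ML L) (Y : TangentSpace (IVelCovel k n) (inclML L m)),
    ∑ A, Omega A (inclML L m)
      (mfderiv (IVel k n) (IVelCovel k n) (inclML L) m (Z A m)) Y =
      differential (IVelCovel k n) (hamiltonian L) (inclML L m) Y

/-- The equation pulled back to `M_L`: `∑_A i_{Z_A} (j^* Ω_A) = d (j^* H)`. -/
def SolvesUnifiedOnML (Z : Fin k → ∀ m : ML L, TangentSpace (IVel k n) m) : Prop :=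
  ∀ (m : ML L) (Y : TangentSpace (IVel k n) m),
    ∑ A, Omega A (inclML L m)
      (mfderiv (IVel k n) (IVelCovel k n) (inclML L) m (Z A m))
      (mfderiv (IVel k n) (IVelCovel k n) (inclML L) m Y) =
      differential (IVel k n) (fun m' => hamiltonian L (inclML L m')) m Y

/-- The `k`-vector field `T¹ₖ(pr₁⁰) ∘ Z ∘ (pr₁⁰)⁻¹` on `T¹ₖQ`. -/
def pushforward (Z : Fin k → ∀ m : ML L, TangentSpace (IVel k n) m) :
    Fin k → ∀ v : Vel k n Q, TangentSpace (IVel k n) v :=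
  fun A v => mfderiv (IVel k n) (IVel k n) (pr1ML L) ((pr1ML L).symm v) (Z A ((pr1ML L).symm v))

end KSymplectic

end

open KSymplectic

/-!
Everything follows from one computation in natural coordinates. Fix `v = (q, u)` in `T¹ₖQ` and use, on
each of the bundles involved, the chart induced by the preferred chart of `Q` at `q`. The tangent space
at the centre of a chart is identified by that chart with the model space, so that tangent vectors of
`T¹ₖQ` at `v` are pairs `(x, w)`. Let `D₁` and `D₂` be the first and second differentials at `v` of the
representative of `L` (`dLag`, `d2Lag`), and write `ι_A e` for the vertical vector `(0, w)` whose tuple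
`w` has the tangent vector `e` of `Q` in the `A`-th place and zeros elsewhere. Then

* `(ω_0)_A ((x, p), (x', p')) = p'^A (x) - p^A (x')` (`omega0_eq`);
* `(ω_L)_A (Y, Y') = D₂ Y' (ι_A x) - D₂ Y (ι_A x')` for `Y = (x, w)`, `Y' = (x', w')` (`omegaL_eq`);
* `dE_L (x, w) = D₂ (x, w) (0, u) - D₁ (x, 0)` (`differential_energy`);
* the inclusion of `M_L` has derivative `(x, w) ↦ (x, w, p)` with `p^A = D₂ (x, w) (ι_A ·)`
  (`mfderiv_inclML`);
* at points of `M_L`, `dH (x, w, p) = ∑ p^A (u_A) - D₁ (x, 0)` (`differential_hamiltonian`), the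
  `dv`-component being zero because the momenta equal `∂L/∂v`.

Let `z_A = (x_A, w_A)` be the components of a `k`-vector field. Testing the unified equation on vertical
covelocities gives `x_A = u_A`, the second order condition, and what remains are the Euler-Lagrange
equations `∑ D₂ z_A (ι_A e) = D₁ (e, 0)` for all `e` (`unifiedAt_iff`). The equation pulled back to
`M_L` is literally the Lagrangian equation, and under the second order condition the latter is
equivalent to the Euler-Lagrange equations. Hence the unified equation for `Z` means that `X_L` is a
second order solution of the Lagrangian equation (`solvesUnified_iff_pushforward`). If `L` is regular,
the vertical part of the Lagrangian equation, `D₂ (0, w) (∑ ι_A (x_A - u_A)) = 0` for all `w`, forces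
the second order condition (`LagrangianAt.sopde`).

Smoothness and integral sections are carried along the diffeomorphism `pr₁⁰`, which is the identity in
the charts used. In particular the integrability of `Z` and of `X_L` are equivalent, and holonomy adds
only the second order condition, which `X_L` satisfies.
-/

namespace KSymplectic

-- instances on iterated spaces of continuous linear maps need a deeper search than the default
set_option maxSynthPendingDepth 3

/-! ### Derivatives and exterior derivatives at the centre of a chart -/

section Manifold

variable {E H M E' H' M' : Type*} [NormedAddCommGroup E] [NormedSpace ℝ E] [TopologicalSpace H]
  {J : ModelWithCorners ℝ E H} [TopologicalSpace M] [ChartedSpace H M]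
  [NormedAddCommGroup E'] [NormedSpace ℝ E'] [TopologicalSpace H']
  {J' : ModelWithCorners ℝ E' H'} [TopologicalSpace M'] [ChartedSpace H' M']

/-- The derivative of a map at `p` is that of its representative `g` in the preferred charts at `p` and
at `f p`, these charts identifying the tangent spaces at their centres with the model spaces. -/
theorem hasMFDerivAt_of_eventually_extChartAt [J.Boundaryless] {f : M → M'} {p : M}
    (hc : ContinuousAt f p) {g : E → E'} {f' : E →L[ℝ] E'}
    (hg : HasFDerivAt g f' (extChartAt J p p))
    (h : ∀ᶠ y in 𝓝 (extChartAt J p p),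
      extChartAt J' (f p) (f ((extChartAt J p).symm y)) = g y) :
    HasMFDerivAt J J' f p f' := by
  refine ⟨hc, ?_⟩
  rw [J.range_eq_univ]
  exact (hg.congr_of_eventuallyEq h).hasFDerivWithinAt

/-- For real functions, continuity follows from the differentiability of the representative. -/
theorem hasMFDerivAt_real_of_eventually [J.Boundaryless] {f : M → ℝ} {p : M}
    {g : E → ℝ} {f' : E →L[ℝ] ℝ} (hg : HasFDerivAt g f' (extChartAt J p p))
    (h : ∀ᶠ y in 𝓝 (extChartAt J p p), f ((extChartAt J p).symm y) = g y) :
    HasMFDerivAt J 𝓘(ℝ) f p f' := by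
  refine hasMFDerivAt_of_eventually_extChartAt ?_ hg h
  have h1 : ContinuousAt (g ∘ extChartAt J p) p :=
    hg.continuousAt.comp (continuousAt_extChartAt p)
  refine h1.congr ?_
  filter_upwards [(continuousAt_extChartAt (I := J) p).eventually h,
    extChartAt_source_mem_nhds (I := J) p] with p' hp hs
  rw [(extChartAt J p).left_inv hs] at hp
  exact hp.symm

theorem extDeriv_ofSubsingleton_apply {η : E → E →L[ℝ] ℝ} {η' : E →L[ℝ] E →L[ℝ] ℝ} {x : E}
    (hη : HasFDerivAt η η' x) (u v : E) :
    extDeriv (fun y => ContinuousAlternatingMap.ofSubsingleton ℝ E ℝ (0 : Fin 1) (η y)) x ![u, v] =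
      η' u v - η' v u := by
  let S : (E →L[ℝ] ℝ) →L[ℝ] (E [⋀^Fin 1]→L[ℝ] ℝ) :=
    (ContinuousAlternatingMap.ofSubsingletonLIE (0 : Fin 1) :
      (E →L[ℝ] ℝ) ≃ₗᵢ[ℝ] (E [⋀^Fin 1]→L[ℝ] ℝ)).toContinuousLinearEquiv
  have h1 : HasFDerivAt
      (fun y => ContinuousAlternatingMap.ofSubsingleton ℝ E ℝ (0 : Fin 1) (η y)) (S.comp η') x :=
    S.hasFDerivAt.comp _ hη
  have hS : ∀ (a : E →L[ℝ] ℝ) (w : Fin 1 → E), S a w = a (w 0) := fun a w => rfl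
  rw [extDeriv, ContinuousAlternatingMap.alternatizeUncurryFin_apply, h1.fderiv,
    Fin.sum_univ_two]
  simp only [Fin.val_zero, Fin.val_one, pow_zero, pow_one, one_smul, neg_smul,
    ContinuousLinearMap.comp_apply, hS]
  rw [← sub_eq_add_neg]
  rfl

/-- The exterior derivative of a one-form `θ` on a manifold is that of its representative `η` in the
chart at the point. -/
theorem extDerivOneForm_eq [IsManifold J 1 M] {θ : ∀ p : M, TangentSpace J p →L[ℝ] ℝ} {p : M}
    {η : E → E →L[ℝ] ℝ} {η' : E →L[ℝ] E →L[ℝ] ℝ}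
    (hη : HasFDerivAt η η' (extChartAt J p p))
    (h : ∀ᶠ y in 𝓝 (extChartAt J p p), ∀ e : E,
      θ ((extChartAt J p).symm y) (mfderiv 𝓘(ℝ, E) J (extChartAt J p).symm y e) = η y e)
    (u v : E) :
    extDerivOneForm J θ p u v = η' u v - η' v u := by
  have h2 : (fun y : E =>
      ContinuousAlternatingMap.ofSubsingleton ℝ E ℝ (0 : Fin 1)
        ((θ ((extChartAt J p).symm y)).comp (mfderiv 𝓘(ℝ, E) J (extChartAt J p).symm y)))
      =ᶠ[𝓝 (extChartAt J p p)]
      fun y => ContinuousAlternatingMap.ofSubsingleton ℝ E ℝ (0 : Fin 1) (η y) := by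
    filter_upwards [h] with y hy
    ext w
    exact hy (w 0)
  have hid : (mfderiv J 𝓘(ℝ, E) (extChartAt J p) p : E →L[ℝ] E) = ContinuousLinearMap.id ℝ E :=
    mfderiv_extChartAt_self
  unfold extDerivOneForm
  rw [h2.extDeriv_eq, ← extDeriv_ofSubsingleton_apply hη]
  exact congrArg (fun T : E →L[ℝ] E => extDeriv _ _ ![T u, T v]) hid

end Manifold

/-! ### Natural charts of the bundles -/

section Charts

variable {k n : ℕ} {Q : Type*} [TopologicalSpace Q] [ChartedSpace (EuclideanSpace ℝ (Fin n)) Q]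
  [IsManifold (𝓡 n) ∞ Q]

variable (n) in
/-- The derivative at `q` of the preferred chart around `q₀`, with `T_qQ` identified with `ℝⁿ` by the
preferred chart at `q`. Outside the domain of the chart around `q₀` it is zero. -/
noncomputable abbrev tanCoord (q₀ q : Q) : EuclideanSpace ℝ (Fin n) →L[ℝ] EuclideanSpace ℝ (Fin n) :=
  (trivializationAt (EuclideanSpace ℝ (Fin n)) (TangentSpace (𝓡 n)) q₀).continuousLinearMapAt ℝ q

variable (n) in
/-- The inverse of `tanCoord q₀ q`, for `q` in the domain of the chart. -/
noncomputable abbrev tanCoordSymm (q₀ q : Q) : EuclideanSpace ℝ (Fin n) →L[ℝ] EuclideanSpace ℝ (Fin n) :=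
  (trivializationAt (EuclideanSpace ℝ (Fin n)) (TangentSpace (𝓡 n)) q₀).symmL ℝ q

theorem tanCoord_self (q : Q) : tanCoord n q q = ContinuousLinearMap.id ℝ _ := by
  have := TangentBundle.continuousLinearMapAt_trivializationAt (I := 𝓡 n) (mem_chart_source _ q)
  exact this.trans mfderiv_extChartAt_self

theorem tanCoord_tanCoordSymm {q₀ q : Q} (hq : q ∈ (chartAt (EuclideanSpace ℝ (Fin n)) q₀).source)
    (e : EuclideanSpace ℝ (Fin n)) : tanCoord n q₀ q (tanCoordSymm n q₀ q e) = e :=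
  (trivializationAt (EuclideanSpace ℝ (Fin n)) (TangentSpace (𝓡 n))
    q₀).continuousLinearMapAt_symmL (by simpa using hq) e

theorem tanCoordSymm_tanCoord {q₀ q : Q} (hq : q ∈ (chartAt (EuclideanSpace ℝ (Fin n)) q₀).source)
    (e : EuclideanSpace ℝ (Fin n)) : tanCoordSymm n q₀ q (tanCoord n q₀ q e) = e :=
  (trivializationAt (EuclideanSpace ℝ (Fin n)) (TangentSpace (𝓡 n))
    q₀).symmL_continuousLinearMapAt (by simpa using hq) e

theorem tanCoordSymm_self (q : Q) : tanCoordSymm n q q = ContinuousLinearMap.id ℝ _ := by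
  ext1 e
  have := tanCoordSymm_tanCoord (mem_chart_source _ q) e
  rwa [tanCoord_self] at this

theorem extChartAt_covel (α₀ α : Covel k n Q) :
    extChartAt (ICovel k n) α₀ α = (extChartAt (𝓡 n) α₀.proj α.proj,
      ((α.snd : CovelModel k n).comp (tanCoordSymm n α₀.proj α.proj) : CovelModel k n)) := by
  rw [FiberBundle.extChartAt]
  simp only [PartialEquiv.coe_trans, PartialEquiv.prod_coe, Function.comp_apply,
    PartialEquiv.refl_coe, id, OpenPartialHomeomorph.coe_toPartialEquiv, Trivialization.coe_coe]
  rw [hom_trivializationAt_apply]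
  refine Prod.ext rfl ?_
  ext w i
  simp [ContinuousLinearMap.inCoordinates]

theorem extChartAt_velCovel (w₀ w : VelCovel k n Q) :
    extChartAt (IVelCovel k n) w₀ w = (extChartAt (𝓡 n) w₀.proj w.proj,
      (((tanCoord n w₀.proj w.proj).comp (w.snd.1 : VelModel k n) : VelModel k n),
      ((w.snd.2 : CovelModel k n).comp (tanCoordSymm n w₀.proj w.proj) : CovelModel k n))) := by
  have h1 := extChartAt_vel (pr1 w₀) (pr1 w)
  have h2 := extChartAt_covel (pr2 w₀) (pr2 w)
  rw [FiberBundle.extChartAt] at h1 h2 ⊢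
  have h1' := (congrArg Prod.snd h1 :)
  have h2' := (congrArg Prod.snd h2 :)
  refine Prod.ext rfl (Prod.ext ?_ ?_)
  · exact h1'
  · exact h2'

theorem mem_source_vel {v₀ v : Vel k n Q} :
    v ∈ (extChartAt (IVel k n) v₀).source ↔
      v.proj ∈ (chartAt (EuclideanSpace ℝ (Fin n)) v₀.proj).source := by
  rw [FiberBundle.extChartAt]
  simp only [PartialEquiv.trans_source, PartialEquiv.prod_source, mem_inter_iff, mem_preimage,
    mem_prod, PartialEquiv.refl_source, mem_univ, and_true, extChartAt_source,
    OpenPartialHomeomorph.coe_toPartialEquiv]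
  refine ⟨fun h => h.2, fun h => ⟨?_, h⟩⟩
  simpa [Trivialization.mem_source] using h

theorem mem_source_covel {v₀ v : Covel k n Q} :
    v ∈ (extChartAt (ICovel k n) v₀).source ↔
      v.proj ∈ (chartAt (EuclideanSpace ℝ (Fin n)) v₀.proj).source := by
  rw [FiberBundle.extChartAt]
  simp only [PartialEquiv.trans_source, PartialEquiv.prod_source, mem_inter_iff, mem_preimage,
    mem_prod, PartialEquiv.refl_source, mem_univ, and_true, extChartAt_source,
    OpenPartialHomeomorph.coe_toPartialEquiv]
  refine ⟨fun h => h.2, fun h => ⟨?_, h⟩⟩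
  simpa [Trivialization.mem_source] using h

theorem mem_source_velCovel {v₀ v : VelCovel k n Q} :
    v ∈ (extChartAt (IVelCovel k n) v₀).source ↔
      v.proj ∈ (chartAt (EuclideanSpace ℝ (Fin n)) v₀.proj).source := by
  rw [FiberBundle.extChartAt]
  simp only [PartialEquiv.trans_source, PartialEquiv.prod_source, mem_inter_iff, mem_preimage,
    mem_prod, PartialEquiv.refl_source, mem_univ, and_true, extChartAt_source,
    OpenPartialHomeomorph.coe_toPartialEquiv]
  refine ⟨fun h => h.2, fun h => ⟨?_, h⟩⟩
  simpa [Trivialization.mem_source] using h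

end Charts

/-! ### The derivative of a bundle projection in bundle charts -/

section Projection

variable {n : ℕ} {Q : Type*} [TopologicalSpace Q] [ChartedSpace (EuclideanSpace ℝ (Fin n)) Q]
  [IsManifold (𝓡 n) ∞ Q]
  {F : Type*} [NormedAddCommGroup F] [NormedSpace ℝ F] {V : Q → Type*}
  [TopologicalSpace (TotalSpace F V)] [∀ q, TopologicalSpace (V q)]
  [∀ q, AddCommGroup (V q)] [∀ q, Module ℝ (V q)] [FiberBundle F V] [VectorBundle ℝ F V]
  [ContMDiffVectorBundle ∞ F V (𝓡 n)]

/-- In the bundle charts around `p₀` and around its base point, the derivative of a bundle projection is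
the projection to the first factor, at every point of the chart domain. -/
theorem tanCoord_mfderiv_proj {p₀ : TotalSpace F V} {y : EuclideanSpace ℝ (Fin n) × F}
    (hy : y ∈ (extChartAt ((𝓡 n).prod 𝓘(ℝ, F)) p₀).target)
    (e : EuclideanSpace ℝ (Fin n) × F) :
    tanCoord n p₀.proj ((extChartAt ((𝓡 n).prod 𝓘(ℝ, F)) p₀).symm y).proj
      (mfderiv ((𝓡 n).prod 𝓘(ℝ, F)) (𝓡 n) (TotalSpace.proj : TotalSpace F V → Q)
        ((extChartAt ((𝓡 n).prod 𝓘(ℝ, F)) p₀).symm y)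
        (mfderiv 𝓘(ℝ, EuclideanSpace ℝ (Fin n) × F) ((𝓡 n).prod 𝓘(ℝ, F))
          (extChartAt ((𝓡 n).prod 𝓘(ℝ, F)) p₀).symm y e)) = e.1 := by
  set c := extChartAt ((𝓡 n).prod 𝓘(ℝ, F)) p₀ with hc
  have hmem : ∀ p : TotalSpace F V, p ∈ c.source →
      p.proj ∈ (chartAt (EuclideanSpace ℝ (Fin n)) p₀.proj).source ∧
        (c p).1 = extChartAt (𝓡 n) p₀.proj p.proj := by
    intro p hp
    rw [hc, FiberBundle.extChartAt] at hp ⊢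
    simp only [PartialEquiv.trans_source, PartialEquiv.prod_source, mem_inter_iff, mem_preimage,
      mem_prod, PartialEquiv.refl_source, mem_univ, and_true, extChartAt_source,
      OpenPartialHomeomorph.coe_toPartialEquiv] at hp
    have h1 : (trivializationAt F V p₀.proj p).1 = p.proj :=
      (trivializationAt F V p₀.proj).coe_fst hp.1
    refine ⟨h1 ▸ hp.2, ?_⟩
    simp only [PartialEquiv.coe_trans, PartialEquiv.prod_coe, Function.comp_apply]
    exact congrArg _ h1
  have hys := hmem _ (c.map_target hy)
  have d1 : MDifferentiableAt 𝓘(ℝ, EuclideanSpace ℝ (Fin n) × F) ((𝓡 n).prod 𝓘(ℝ, F)) c.symm y := by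
    have := mdifferentiableWithinAt_extChartAt_symm hy
    rwa [ModelWithCorners.range_eq_univ, mdifferentiableWithinAt_univ] at this
  have d2 : MDifferentiableAt ((𝓡 n).prod 𝓘(ℝ, F)) (𝓡 n) (TotalSpace.proj : TotalSpace F V → Q)
      (c.symm y) := (contMDiffAt_proj V (n := ∞)).mdifferentiableAt (by simp)
  have d3 : MDifferentiableAt (𝓡 n) 𝓘(ℝ, EuclideanSpace ℝ (Fin n))
      (extChartAt (𝓡 n) p₀.proj) (c.symm y).proj := mdifferentiableAt_extChartAt hys.1
  have d := d3.hasMFDerivAt.comp y (d2.hasMFDerivAt.comp y d1.hasMFDerivAt)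
  have d' : HasMFDerivAt 𝓘(ℝ, EuclideanSpace ℝ (Fin n) × F) 𝓘(ℝ, EuclideanSpace ℝ (Fin n))
      (Prod.fst : EuclideanSpace ℝ (Fin n) × F → _) y
      (ContinuousLinearMap.fst ℝ (EuclideanSpace ℝ (Fin n)) F) :=
    (ContinuousLinearMap.fst ℝ (EuclideanSpace ℝ (Fin n)) F).hasFDerivAt.hasMFDerivAt
  have heq : (extChartAt (𝓡 n) p₀.proj) ∘ (TotalSpace.proj : TotalSpace F V → Q) ∘ c.symm
      =ᶠ[𝓝 y] Prod.fst := by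
    filter_upwards [(isOpen_extChartAt_target p₀).mem_nhds hy] with z hz
    have := (hmem _ (c.map_target hz)).2
    rw [c.right_inv hz] at this
    exact this.symm
  have hu := hasMFDerivAt_unique d (d'.congr_of_eventuallyEq heq)
  have h4 : tanCoord n p₀.proj (c.symm y).proj = _ :=
    TangentBundle.continuousLinearMapAt_trivializationAt (I := 𝓡 n) hys.1
  rw [h4]
  exact congrArg (fun T : (EuclideanSpace ℝ (Fin n) × F) →L[ℝ] EuclideanSpace ℝ (Fin n) => T e) hu

end Projection

/-! ### Fibre derivatives and the local Lagrangian -/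

section Local

variable {k n : ℕ} {Q : Type*} [TopologicalSpace Q] [ChartedSpace (EuclideanSpace ℝ (Fin n)) Q]
  [IsManifold (𝓡 n) ∞ Q]

theorem extChartAt_vel_self (v : Vel k n Q) :
    extChartAt (IVel k n) v v = (extChartAt (𝓡 n) v.proj v.proj, (v.snd : VelModel k n)) := by
  rw [extChartAt_vel]
  refine Prod.ext rfl ?_
  exact congrArg (fun T : EuclideanSpace ℝ (Fin n) →L[ℝ] EuclideanSpace ℝ (Fin n) =>
    T.comp (v.snd : VelModel k n)) (tanCoord_self v.proj)

theorem extChartAt_velCovel_self (v : VelCovel k n Q) :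
    extChartAt (IVelCovel k n) v v = (extChartAt (𝓡 n) v.proj v.proj,
      ((v.snd.1 : VelModel k n), (v.snd.2 : CovelModel k n))) := by
  rw [extChartAt_velCovel, tanCoordSymm_self, tanCoord_self]
  rfl

theorem mdifferentiableAt_fiberIncl (q : Q) (u : VelModel k n) :
    MDifferentiableAt 𝓘(ℝ, VelModel k n) (IVel k n) (fiberIncl q) u := by
  rw [mdifferentiableAt_hom_bundle]
  refine ⟨mdifferentiableAt_const, ?_⟩
  let a : VelModel k n →L[ℝ] VelModel k n :=
    ContinuousLinearMap.compL ℝ (Fin k → ℝ) (EuclideanSpace ℝ (Fin n)) (EuclideanSpace ℝ (Fin n))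
      (tanCoord n q q)
  refine (a.hasFDerivAt.hasMFDerivAt.mdifferentiableAt :
    MDifferentiableAt 𝓘(ℝ, VelModel k n) 𝓘(ℝ, VelModel k n) a u).congr_of_eventuallyEq ?_
  refine Filter.Eventually.of_forall fun u' => ?_
  ext w i
  simp [ContinuousLinearMap.inCoordinates, fiberIncl, a]
  rfl

variable (L : Lagrangian k n Q)

/-- The derivative of `L` along the fibre of `T¹ₖQ` through `v`. -/
noncomputable def fiberDeriv (v : Vel k n Q) : VelModel k n →L[ℝ] ℝ :=
  fderiv ℝ (fun u : VelModel k n => L (fiberIncl v.proj u)) v.snd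

theorem mdifferentiableAt_lagrangian (v : Vel k n Q) :
    MDifferentiableAt (IVel k n) 𝓘(ℝ) L v :=
  L.contMDiff.contMDiffAt.mdifferentiableAt (by simp)

/-- The vertical lift is the derivative of the inclusion of the fibre, hence `dL` applied to it is the
derivative of `L` along the fibre. -/
theorem differential_verticalLift (v : Vel k n Q) (u : VelModel k n) :
    differential (IVel k n) L v (verticalLift v u) = fiberDeriv L v u := by
  obtain ⟨q, x⟩ := v
  change VelModel k n at x
  have h1 : HasMFDerivAt 𝓘(ℝ, VelModel k n) (IVel k n) (fiberIncl q) x (verticalLift ⟨q, x⟩) :=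
    (mdifferentiableAt_fiberIncl q x).hasMFDerivAt
  have h2 : HasMFDerivAt (IVel k n) 𝓘(ℝ) L (fiberIncl q x) (differential (IVel k n) L ⟨q, x⟩) :=
    (mdifferentiableAt_lagrangian L ⟨q, x⟩).hasMFDerivAt
  have h3 := (h2.comp x h1).mfderiv
  rw [mfderiv_eq_fderiv] at h3
  exact (congrArg (fun T : VelModel k n →L[ℝ] ℝ => T u) h3).symm

theorem thetaL_apply (A : Fin k) (v : Vel k n Q) (Z : TangentSpace (IVel k n) v) :
    thetaL L A v Z = fiberDeriv L v (coordIncl A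
      (mfderiv (IVel k n) (𝓡 n) (TotalSpace.proj : Vel k n Q → Q) v Z)) :=
  differential_verticalLift L v _

theorem liouville_eq (v : Vel k n Q) : liouville v = verticalLift v v.snd := by
  obtain ⟨q, x⟩ := v
  change VelModel k n at x
  have h0 : HasDerivAt (fun s : ℝ => Real.exp s • x) x 0 := by
    simpa using (Real.hasDerivAt_exp 0).smul_const x
  have h0' : HasMFDerivAt 𝓘(ℝ) 𝓘(ℝ, VelModel k n)
      (fun s : ℝ => Real.exp s • x) 0 (ContinuousLinearMap.toSpanSingleton ℝ x) :=
    h0.hasFDerivAt.hasMFDerivAt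
  have h1 : HasMFDerivAt 𝓘(ℝ, VelModel k n) (IVel k n) (fiberIncl q)
      (Real.exp 0 • x) (verticalLift (⟨q, x⟩ : Vel k n Q)) := by
    rw [Real.exp_zero, one_smul]
    exact (mdifferentiableAt_fiberIncl q x).hasMFDerivAt
  have h3 := (h1.comp (0 : ℝ) h0').mfderiv
  refine (congrArg (fun T : ℝ →L[ℝ] (EuclideanSpace ℝ (Fin n) × VelModel k n) => T 1) h3).trans ?_
  exact congrArg (verticalLift (⟨q, x⟩ : Vel k n Q)) (one_smul ℝ x)

theorem energy_eq (v : Vel k n Q) : energy L v = fiberDeriv L v v.snd - L v := by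
  rw [energy, liouville_eq]
  exact congrArg (· - L v) (differential_verticalLift L v v.snd)

/-- The representative of `L` in the natural chart of `T¹ₖQ` around `v₀`. -/
noncomputable def localLagrangian (v₀ : Vel k n Q)
    (y : EuclideanSpace ℝ (Fin n) × VelModel k n) : ℝ :=
  L ((extChartAt (IVel k n) v₀).symm y)

theorem contDiffOn_localLagrangian (v₀ : Vel k n Q) :
    ContDiffOn ℝ ∞ (localLagrangian L v₀) (extChartAt (IVel k n) v₀).target := by
  rw [← contMDiffOn_iff_contDiffOn]
  exact L.contMDiff.comp_contMDiffOn (contMDiffOn_extChartAt_symm v₀)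

theorem differentiableAt_localLagrangian {v₀ : Vel k n Q}
    {y : EuclideanSpace ℝ (Fin n) × VelModel k n} (hy : y ∈ (extChartAt (IVel k n) v₀).target) :
    DifferentiableAt ℝ (localLagrangian L v₀) y :=
  ((contDiffOn_localLagrangian L v₀).contDiffAt
    ((isOpen_extChartAt_target v₀).mem_nhds hy)).differentiableAt (by simp)

theorem differentiableAt_fderiv_localLagrangian {v₀ : Vel k n Q}
    {y : EuclideanSpace ℝ (Fin n) × VelModel k n} (hy : y ∈ (extChartAt (IVel k n) v₀).target) :
    DifferentiableAt ℝ (fderiv ℝ (localLagrangian L v₀)) y :=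
  (((contDiffOn_localLagrangian L v₀).fderiv_of_isOpen (isOpen_extChartAt_target v₀) (m := ∞)
    (by simp)).contDiffAt
    ((isOpen_extChartAt_target v₀).mem_nhds hy)).differentiableAt (by simp)

theorem lagrangian_eq_localLagrangian {v₀ v : Vel k n Q}
    (hv : v.proj ∈ (chartAt (EuclideanSpace ℝ (Fin n)) v₀.proj).source) :
    L v = localLagrangian L v₀ (extChartAt (IVel k n) v₀ v) :=
  congrArg L ((extChartAt (IVel k n) v₀).left_inv (mem_source_vel.2 hv)).symm

/-- The fibre derivative at `v`, computed in the natural chart around another point `v₀`. -/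
theorem fiberDeriv_eq {v₀ v : Vel k n Q}
    (hv : v.proj ∈ (chartAt (EuclideanSpace ℝ (Fin n)) v₀.proj).source) (u : VelModel k n) :
    fiberDeriv L v u = fderiv ℝ (localLagrangian L v₀) (extChartAt (IVel k n) v₀ v)
      (0, (tanCoord n v₀.proj v.proj).comp u) := by
  let a : VelModel k n →L[ℝ] VelModel k n :=
    ContinuousLinearMap.compL ℝ (Fin k → ℝ) (EuclideanSpace ℝ (Fin n)) (EuclideanSpace ℝ (Fin n))
      (tanCoord n v₀.proj v.proj)
  have hGd := differentiableAt_localLagrangian L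
    ((extChartAt (IVel k n) v₀).map_source (mem_source_vel.2 hv))
  rw [fiberDeriv]
  rw [extChartAt_vel] at hGd ⊢
  generalize hx : (v.snd : VelModel k n) = x at hGd ⊢
  have h1 : HasFDerivAt (fun u : VelModel k n => (extChartAt (𝓡 n) v₀.proj v.proj, a u))
      ((ContinuousLinearMap.inr ℝ _ _).comp a) x :=
    (hasFDerivAt_const (extChartAt (𝓡 n) v₀.proj v.proj) x).prodMk a.hasFDerivAt
  have h2 := HasFDerivAt.comp x (f := fun u => (extChartAt (𝓡 n) v₀.proj v.proj, a u))
    hGd.hasFDerivAt h1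
  have h3 : (fun u : VelModel k n => L (fiberIncl v.proj u)) =
      localLagrangian L v₀ ∘ fun u => (extChartAt (𝓡 n) v₀.proj v.proj, a u) := by
    funext u
    rw [lagrangian_eq_localLagrangian L (v := fiberIncl v.proj u) hv, extChartAt_vel]
    rfl
  rw [h3, h2.fderiv]
  rfl

theorem sum_coordIncl (u : VelModel k n) :
    ∑ A, coordIncl A (u (Pi.single A 1 : Fin k → ℝ)) = u := by
  ext1 r
  rw [sum_apply]
  conv_rhs => rw [pi_eq_sum_univ' r, map_sum]
  refine Finset.sum_congr rfl fun A _ => ?_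
  rw [map_smul]
  exact congrArg (fun s : Fin k → ℝ => r A • u s) (by ext i; simp [Pi.single_apply, eq_comm])

theorem comp_coordIncl (a : EuclideanSpace ℝ (Fin n) →L[ℝ] EuclideanSpace ℝ (Fin n)) (A : Fin k)
    (e : EuclideanSpace ℝ (Fin n)) : a.comp (coordIncl A e) = coordIncl A (a e) := by
  ext1 r
  exact a.map_smul (r A) e

end Local

/-! ### The canonical forms and the energy in natural coordinates -/

section Local

variable {k n : ℕ} {Q : Type*} [TopologicalSpace Q] [ChartedSpace (EuclideanSpace ℝ (Fin n)) Q]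
  [IsManifold (𝓡 n) ∞ Q]

theorem eventually_mem_target {E H M : Type*} [NormedAddCommGroup E] [NormedSpace ℝ E]
    [TopologicalSpace H] {J : ModelWithCorners ℝ E H} [J.Boundaryless] [TopologicalSpace M]
    [ChartedSpace H M] (p : M) :
    ∀ᶠ y in 𝓝 (extChartAt J p p), y ∈ (extChartAt J p).target :=
  (isOpen_extChartAt_target p).mem_nhds (mem_extChartAt_target p)

/-- Reading off the natural coordinates `y` of a point `v` in the chart around `v₀`. -/
theorem vel_symm_spec {v₀ v : Vel k n Q} {y : EuclideanSpace ℝ (Fin n) × VelModel k n}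
    (hy : y ∈ (extChartAt (IVel k n) v₀).target) (hv : (extChartAt (IVel k n) v₀).symm y = v) :
    v.proj ∈ (chartAt (EuclideanSpace ℝ (Fin n)) v₀.proj).source ∧
      extChartAt (𝓡 n) v₀.proj v.proj = y.1 ∧
      (tanCoord n v₀.proj v.proj).comp (v.snd : VelModel k n) = y.2 := by
  subst hv
  have h := (extChartAt (IVel k n) v₀).right_inv hy
  rw [extChartAt_vel] at h
  exact ⟨mem_source_vel.1 ((extChartAt (IVel k n) v₀).map_target hy), congrArg Prod.fst h,
    congrArg Prod.snd h⟩

theorem covel_symm_spec {v₀ v : Covel k n Q} {y : EuclideanSpace ℝ (Fin n) × CovelModel k n}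
    (hy : y ∈ (extChartAt (ICovel k n) v₀).target) (hv : (extChartAt (ICovel k n) v₀).symm y = v) :
    v.proj ∈ (chartAt (EuclideanSpace ℝ (Fin n)) v₀.proj).source ∧
      extChartAt (𝓡 n) v₀.proj v.proj = y.1 ∧
      (v.snd : CovelModel k n).comp (tanCoordSymm n v₀.proj v.proj) = y.2 := by
  subst hv
  have h := (extChartAt (ICovel k n) v₀).right_inv hy
  rw [extChartAt_covel] at h
  exact ⟨mem_source_covel.1 ((extChartAt (ICovel k n) v₀).map_target hy), congrArg Prod.fst h,
    congrArg Prod.snd h⟩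

theorem velCovel_symm_spec {v₀ v : VelCovel k n Q}
    {y : EuclideanSpace ℝ (Fin n) × VelModel k n × CovelModel k n}
    (hy : y ∈ (extChartAt (IVelCovel k n) v₀).target)
    (hv : (extChartAt (IVelCovel k n) v₀).symm y = v) :
    v.proj ∈ (chartAt (EuclideanSpace ℝ (Fin n)) v₀.proj).source ∧
      extChartAt (𝓡 n) v₀.proj v.proj = y.1 ∧
      (tanCoord n v₀.proj v.proj).comp (v.snd.1 : VelModel k n) = y.2.1 ∧
      (v.snd.2 : CovelModel k n).comp (tanCoordSymm n v₀.proj v.proj) = y.2.2 := by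
  subst hv
  have h := (extChartAt (IVelCovel k n) v₀).right_inv hy
  rw [extChartAt_velCovel] at h
  exact ⟨mem_source_velCovel.1 ((extChartAt (IVelCovel k n) v₀).map_target hy),
    congrArg Prod.fst h, congrArg (fun z => z.2.1) h, congrArg (fun z => z.2.2) h⟩

/-- The bilinear form `(x, p), (x', p') ↦ B p x'`. -/
noncomputable def mixedForm {E P : Type*} [NormedAddCommGroup E] [NormedSpace ℝ E]
    [NormedAddCommGroup P] [NormedSpace ℝ P] (B : P →L[ℝ] E →L[ℝ] ℝ) :
    (E × P) →L[ℝ] (E × P) →L[ℝ] ℝ :=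
  ((ContinuousLinearMap.compL ℝ (E × P) E ℝ).flip (ContinuousLinearMap.fst ℝ E P)).comp
    (B.comp (ContinuousLinearMap.snd ℝ E P))

/-- Precomposition of linear forms with the continuous linear map `c`. -/
noncomputable def precompForm {E F : Type*} [NormedAddCommGroup E] [NormedSpace ℝ E]
    [NormedAddCommGroup F] [NormedSpace ℝ F] (c : E →L[ℝ] F) : (F →L[ℝ] ℝ) →L[ℝ] (E →L[ℝ] ℝ) :=
  (ContinuousLinearMap.compL ℝ E F ℝ).flip c

theorem precompForm_apply {E F : Type*} [NormedAddCommGroup E] [NormedSpace ℝ E]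
    [NormedAddCommGroup F] [NormedSpace ℝ F] (c : E →L[ℝ] F) (f : F →L[ℝ] ℝ) (e : E) :
    precompForm c f e = f (c e) := rfl

/-- In natural coordinates `(θ_0)_A = p_i^A dq^i`, so that `(ω_0)_A = dq^i ∧ dp_i^A`. -/
theorem omega0_eq (A : Fin k) (α : Covel k n Q) (Y Z : EuclideanSpace ℝ (Fin n) × CovelModel k n) :
    omega0 A α Y Z = Z.2 Y.1 A - Y.2 Z.1 A := by
  let η := mixedForm (ContinuousLinearMap.compL ℝ (EuclideanSpace ℝ (Fin n)) (Fin k → ℝ) ℝ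
    (ContinuousLinearMap.proj A))
  have hη : ∀ y e : EuclideanSpace ℝ (Fin n) × CovelModel k n, η y e = y.2 e.1 A :=
    fun y e => rfl
  have hd : HasFDerivAt (fun y => η y) η (extChartAt (ICovel k n) α α) := η.hasFDerivAt
  have key := extDerivOneForm_eq (J := ICovel k n) (θ := theta0 A) (p := α) hd ?_ Y Z
  · change -(extDerivOneForm (ICovel k n) (theta0 A) α Y Z) = _
    rw [key, hη, hη]
    ring
  · filter_upwards [eventually_mem_target (J := ICovel k n) α] with y hy e
    rw [hη]
    have h1 := tanCoord_mfderiv_proj hy e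
    obtain ⟨hs, -, h2⟩ := covel_symm_spec hy rfl
    generalize hX : (mfderiv 𝓘(ℝ, EuclideanSpace ℝ (Fin n) × CovelModel k n) (ICovel k n)
          (extChartAt (ICovel k n) α).symm y e) = X at h1 ⊢
    rw [← h1, ← h2]
    exact congrArg (fun x => (((extChartAt (ICovel k n) α).symm y).snd : CovelModel k n) x A)
      (tanCoordSymm_tanCoord hs _).symm

variable (L : Lagrangian k n Q)

/-- The differential at the centre `v` of the natural chart of the representative of `L`. -/
noncomputable def dLag (v : Vel k n Q) : (EuclideanSpace ℝ (Fin n) × VelModel k n) →L[ℝ] ℝ :=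
  fderiv ℝ (localLagrangian L v) (extChartAt (IVel k n) v v)

/-- The second differential at the centre `v` of the natural chart of the representative of `L`. -/
noncomputable def d2Lag (v : Vel k n Q) : (EuclideanSpace ℝ (Fin n) × VelModel k n) →L[ℝ]
    (EuclideanSpace ℝ (Fin n) × VelModel k n) →L[ℝ] ℝ :=
  fderiv ℝ (fderiv ℝ (localLagrangian L v)) (extChartAt (IVel k n) v v)

theorem hasFDerivAt_localLagrangian (v : Vel k n Q) :
    HasFDerivAt (localLagrangian L v) (dLag L v) (extChartAt (IVel k n) v v) :=
  (differentiableAt_localLagrangian L (mem_extChartAt_target v)).hasFDerivAt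

theorem hasFDerivAt_fderiv_localLagrangian (v : Vel k n Q) :
    HasFDerivAt (fderiv ℝ (localLagrangian L v)) (d2Lag L v) (extChartAt (IVel k n) v v) :=
  (differentiableAt_fderiv_localLagrangian L (mem_extChartAt_target v)).hasFDerivAt

/-- The fibre derivative in the natural chart around `v₀`. -/
theorem fiberDeriv_symm {v₀ : Vel k n Q} {y : EuclideanSpace ℝ (Fin n) × VelModel k n}
    (hy : y ∈ (extChartAt (IVel k n) v₀).target) (u : VelModel k n) :
    fiberDeriv L ((extChartAt (IVel k n) v₀).symm y) u = fderiv ℝ (localLagrangian L v₀) y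
      (0, (tanCoord n v₀.proj ((extChartAt (IVel k n) v₀).symm y).proj).comp u) := by
  rw [fiberDeriv_eq L (vel_symm_spec hy rfl).1, (extChartAt (IVel k n) v₀).right_inv hy]

/-- In natural coordinates `(θ_L)_A = (∂L/∂v^i_A) dq^i`, which gives `(ω_L)_A` in terms of the second
differential of the local Lagrangian. -/
theorem omegaL_eq (A : Fin k) (v : Vel k n Q) (Y Z : EuclideanSpace ℝ (Fin n) × VelModel k n) :
    omegaL L A v Y Z = d2Lag L v Z (0, coordIncl A Y.1) - d2Lag L v Y (0, coordIncl A Z.1) := by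
  let c : (EuclideanSpace ℝ (Fin n) × VelModel k n) →L[ℝ]
      EuclideanSpace ℝ (Fin n) × VelModel k n :=
    (ContinuousLinearMap.inr ℝ _ _).comp ((coordIncl A).comp (ContinuousLinearMap.fst ℝ _ _))
  have hd : HasFDerivAt (fun y => precompForm c (fderiv ℝ (localLagrangian L v) y))
      ((precompForm c).comp (d2Lag L v)) (extChartAt (IVel k n) v v) :=
    (precompForm c).hasFDerivAt.comp _ (hasFDerivAt_fderiv_localLagrangian L v)
  have key := extDerivOneForm_eq (J := IVel k n) (θ := thetaL L A) (p := v) hd ?_ Y Z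
  · change -(extDerivOneForm (IVel k n) (thetaL L A) v Y Z) = _
    rw [key]
    change -(d2Lag L v Y (0, coordIncl A Z.1) - d2Lag L v Z (0, coordIncl A Y.1)) = _
    ring
  · filter_upwards [eventually_mem_target (J := IVel k n) v] with y hy e
    rw [precompForm_apply, thetaL_apply, fiberDeriv_symm L hy]
    exact congrArg (fun x => fderiv ℝ (localLagrangian L v) y (0, x))
      ((comp_coordIncl _ A _).trans (congrArg (coordIncl A) (tanCoord_mfderiv_proj hy e)))

/-- In natural coordinates `E_L = v^i_A ∂L/∂v^i_A - L`; the terms `(∂L/∂v^i_A) dv^i_A` of `dE_L`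
cancel. -/
theorem differential_energy (v : Vel k n Q) (Z : EuclideanSpace ℝ (Fin n) × VelModel k n) :
    differential (IVel k n) (energy L) v Z =
      d2Lag L v Z (0, (v.snd : VelModel k n)) - dLag L v (Z.1, 0) := by
  let F := EuclideanSpace ℝ (Fin n) × VelModel k n
  let c : F →L[ℝ] F := (ContinuousLinearMap.inr ℝ _ _).comp (ContinuousLinearMap.snd ℝ _ _)
  have hc : ∀ y : F, c y = (0, y.2) := fun y => rfl
  have hg := ((hasFDerivAt_fderiv_localLagrangian L v).clm_apply c.hasFDerivAt).sub
    (hasFDerivAt_localLagrangian L v)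
  have h := hasMFDerivAt_real_of_eventually (J := IVel k n) (f := energy L) (p := v) hg ?_
  · have h1 := congrArg (fun T : F →L[ℝ] ℝ => T Z) h.mfderiv
    refine h1.trans ?_
    have h2 : dLag L v Z = dLag L v (Z.1, 0) + dLag L v (0, Z.2) := by
      rw [← map_add]; simp
    change dLag L v (c Z) + d2Lag L v Z (c (extChartAt (IVel k n) v v)) - dLag L v Z = _
    rw [h2, hc, hc, extChartAt_vel_self]
    ring
  · filter_upwards [eventually_mem_target (J := IVel k n) v] with y hy
    rw [energy_eq]
    refine congrArg₂ (· - ·) ?_ rfl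
    refine (fiberDeriv_symm L hy _).trans ?_
    exact congrArg (fun x => fderiv ℝ (localLagrangian L v) y (0, x)) (vel_symm_spec hy rfl).2.2

theorem continuous_pr2 : Continuous (pr2 : VelCovel k n Q → Covel k n Q) :=
  continuous_snd.comp (FiberBundle.Prod.isInducing_diag (VelModel k n) (VelFiber k n Q)
      (CovelModel k n) (CovelFiber k n Q)).continuous

theorem mfderiv_pr2 (w : VelCovel k n Q)
    (Y : EuclideanSpace ℝ (Fin n) × VelModel k n × CovelModel k n) :
    mfderiv (IVelCovel k n) (ICovel k n) pr2 w Y = (Y.1, Y.2.2) := by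
  let F := EuclideanSpace ℝ (Fin n) × VelModel k n × CovelModel k n
  let c : F →L[ℝ] EuclideanSpace ℝ (Fin n) × CovelModel k n :=
    (ContinuousLinearMap.fst ℝ _ _).prod
      ((ContinuousLinearMap.snd ℝ _ _).comp (ContinuousLinearMap.snd ℝ _ _))
  have h := hasMFDerivAt_of_eventually_extChartAt (J := IVelCovel k n) (J' := ICovel k n)
    (f := pr2) (p := w) continuous_pr2.continuousAt c.hasFDerivAt ?_
  · exact congrArg (fun T : F →L[ℝ] EuclideanSpace ℝ (Fin n) × CovelModel k n => T Y) h.mfderiv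
  · filter_upwards [eventually_mem_target (J := IVelCovel k n) w] with y hy
    obtain ⟨-, h1, -, h2⟩ := velCovel_symm_spec hy rfl
    rw [extChartAt_covel]
    exact Prod.ext h1 h2

theorem Omega_eq (A : Fin k) (w : VelCovel k n Q)
    (Y Z : EuclideanSpace ℝ (Fin n) × VelModel k n × CovelModel k n) :
    Omega A w Y Z = Z.2.2 Y.1 A - Y.2.2 Z.1 A := by
  have h := omega0_eq A (pr2 w) (Y.1, Y.2.2) (Z.1, Z.2.2)
  rw [← h]
  exact congrArg₂ (omega0 A (pr2 w)) (mfderiv_pr2 w Y) (mfderiv_pr2 w Z)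

end Local

/-! ### Tuples of covectors and their pairing with tuples of vectors -/

section Fibre

variable {X V : Type*} [NormedAddCommGroup X] [NormedSpace ℝ X] [NormedAddCommGroup V]
  [NormedSpace ℝ V] {k : ℕ}

/-- Given maps `c A : X → V`, the linear map sending a linear form `f` on `X × V` to the `k`-tuple of
forms `f (0, c A ·)` on `X`. -/
noncomputable def verticalForms (c : Fin k → X →L[ℝ] V) :
    ((X × V) →L[ℝ] ℝ) →L[ℝ] (X →L[ℝ] (Fin k → ℝ)) :=
  ∑ A, (ContinuousLinearMap.compL ℝ X ℝ (Fin k → ℝ)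
    (ContinuousLinearMap.single ℝ (fun _ : Fin k => ℝ) A)).comp
      (precompForm ((ContinuousLinearMap.inr ℝ X V).comp (c A)))

theorem verticalForms_apply (c : Fin k → X →L[ℝ] V) (f : (X × V) →L[ℝ] ℝ) (e : X) (A : Fin k) :
    verticalForms c f e A = f (0, c A e) := by
  simp [verticalForms, sum_apply, precompForm_apply, Finset.sum_apply, Pi.single_apply]

variable (X k) in
/-- The pairing of a `k`-tuple of covectors with a `k`-tuple of vectors, as a bilinear map. -/
noncomputable def tuplePairing : (X →L[ℝ] (Fin k → ℝ)) →L[ℝ] ((Fin k → ℝ) →L[ℝ] X) →L[ℝ] ℝ :=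
  ∑ A : Fin k, ((ContinuousLinearMap.compL ℝ ((Fin k → ℝ) →L[ℝ] X) X ℝ).flip
    (ContinuousLinearMap.apply ℝ X (Pi.single A 1 : Fin k → ℝ))).comp
      (ContinuousLinearMap.compL ℝ X (Fin k → ℝ) ℝ (ContinuousLinearMap.proj A))

theorem tuplePairing_apply (p : X →L[ℝ] (Fin k → ℝ)) (u : (Fin k → ℝ) →L[ℝ] X) :
    tuplePairing X k p u = ∑ A, p (u (Pi.single A 1 : Fin k → ℝ)) A := by
  simp [tuplePairing, sum_apply]

end Fibre

/-! ### The submanifold `M_L` and the Hamiltonian in natural coordinates -/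

section Local

variable {k n : ℕ} {Q : Type*} [TopologicalSpace Q] [ChartedSpace (EuclideanSpace ℝ (Fin n)) Q]
  [IsManifold (𝓡 n) ∞ Q] (L : Lagrangian k n Q)

variable (k n) in
/-- The linear map sending a differential of a function of `(q, v)` to its vertical part, regarded as
a `k`-tuple of covectors. -/
noncomputable def verticalPart :
    ((EuclideanSpace ℝ (Fin n) × VelModel k n) →L[ℝ] ℝ) →L[ℝ] CovelModel k n :=
  verticalForms coordIncl

theorem verticalPart_apply (f : (EuclideanSpace ℝ (Fin n) × VelModel k n) →L[ℝ] ℝ)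
    (e : EuclideanSpace ℝ (Fin n)) (A : Fin k) :
    verticalPart k n f e A = f (0, coordIncl A e) :=
  verticalForms_apply coordIncl f e A

variable (k n) in
/-- The pairing of velocities and covelocities in coordinates. -/
noncomputable def pairing : CovelModel k n →L[ℝ] VelModel k n →L[ℝ] ℝ :=
  tuplePairing (EuclideanSpace ℝ (Fin n)) k

theorem pairing_apply (p : CovelModel k n) (u : VelModel k n) :
    pairing k n p u = ∑ A, p (u (Pi.single A 1 : Fin k → ℝ)) A :=
  tuplePairing_apply p u

theorem extChartAt_ML_symm (m : ML L) (y : EuclideanSpace ℝ (Fin n) × VelModel k n) :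
    (extChartAt (IVel k n) m).symm y =
      (pr1ML L).symm ((extChartAt (IVel k n) (pr1ML L m)).symm y) := rfl

/-- The chart of `M_L` at `m` is that of `T¹ₖQ` at the projection of `m`, so the projection is the
identity in these charts. -/
theorem hasMFDerivAt_pr1ML (m : ML L) :
    HasMFDerivAt (IVel k n) (IVel k n) (pr1ML L) m
      (ContinuousLinearMap.id ℝ (EuclideanSpace ℝ (Fin n) × VelModel k n)) := by
  refine hasMFDerivAt_of_eventually_extChartAt (pr1ML L).continuous.continuousAt
    (hasFDerivAt_id _) ?_
  filter_upwards [eventually_mem_target (J := IVel k n) m] with y hy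
  exact (extChartAt (IVel k n) m).right_inv hy

/-- Corresponding `k`-vector fields on `M_L` and `T¹ₖQ` have the same components in natural coordinates. -/
theorem pushforward_eq (Z : Fin k → ∀ m : ML L, TangentSpace (IVel k n) m) (A : Fin k)
    (v : Vel k n Q) : pushforward L Z A v = Z A ((pr1ML L).symm v) :=
  congrArg (fun T : (EuclideanSpace ℝ (Fin n) × VelModel k n) →L[ℝ]
    EuclideanSpace ℝ (Fin n) × VelModel k n => T (Z A ((pr1ML L).symm v)))
    (hasMFDerivAt_pr1ML L ((pr1ML L).symm v)).mfderiv

/-- In natural coordinates the inclusion of `M_L` is `(q, v) ↦ (q, v, ∂L/∂v)`. -/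
theorem hasMFDerivAt_inclML (v : Vel k n Q) :
    HasMFDerivAt (IVel k n) (IVelCovel k n) (inclML L) ((pr1ML L).symm v)
      ((ContinuousLinearMap.fst ℝ (EuclideanSpace ℝ (Fin n)) (VelModel k n)).prod
        ((ContinuousLinearMap.snd ℝ (EuclideanSpace ℝ (Fin n)) (VelModel k n)).prod
          ((verticalPart k n).comp (d2Lag L v)))) := by
  have hv : HasFDerivAt (fun y => verticalPart k n (fderiv ℝ (localLagrangian L v) y))
      ((verticalPart k n).comp (d2Lag L v)) (extChartAt (IVel k n) v v) :=
    (verticalPart k n).hasFDerivAt.comp _ (hasFDerivAt_fderiv_localLagrangian L v)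
  have hg := HasFDerivAt.prodMk (hasFDerivAt_fst (𝕜 := ℝ) (p := extChartAt (IVel k n) v v))
    (HasFDerivAt.prodMk (hasFDerivAt_snd (𝕜 := ℝ) (p := extChartAt (IVel k n) v v)) hv)
  refine hasMFDerivAt_of_eventually_extChartAt continuous_subtype_val.continuousAt hg ?_
  filter_upwards [eventually_mem_target (J := IVel k n) v] with y hy
  rw [extChartAt_ML_symm]
  change extChartAt (IVelCovel k n) (inclML L ((pr1ML L).symm v))
    (inclML L ((pr1ML L).symm ((extChartAt (IVel k n) v).symm y))) = _
  rw [extChartAt_velCovel]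
  obtain ⟨hs, h1, h2⟩ := vel_symm_spec hy rfl
  refine Prod.ext h1 (Prod.ext h2 ?_)
  refine ContinuousLinearMap.ext fun e => funext fun A => ?_
  rw [verticalPart_apply]
  change fiberDeriv L ((extChartAt (IVel k n) v).symm y)
    (coordIncl A (tanCoordSymm n v.proj ((extChartAt (IVel k n) v).symm y).proj e)) = _
  rw [fiberDeriv_symm L hy, comp_coordIncl, tanCoord_tanCoordSymm hs]

theorem mfderiv_inclML (v : Vel k n Q) (Y : EuclideanSpace ℝ (Fin n) × VelModel k n) :
    mfderiv (IVel k n) (IVelCovel k n) (inclML L) ((pr1ML L).symm v) Y =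
      (Y.1, (Y.2, verticalPart k n (d2Lag L v Y))) :=
  congrArg (fun T : (EuclideanSpace ℝ (Fin n) × VelModel k n) →L[ℝ]
    EuclideanSpace ℝ (Fin n) × VelModel k n × CovelModel k n => T Y)
    (hasMFDerivAt_inclML L v).mfderiv

theorem pairing_verticalPart (f : (EuclideanSpace ℝ (Fin n) × VelModel k n) →L[ℝ] ℝ)
    (u : VelModel k n) : pairing k n (verticalPart k n f) u = f (0, u) := by
  rw [pairing_apply]
  simp only [verticalPart_apply]
  have h : ∀ x : VelModel k n, f (0, x) = (f.comp (ContinuousLinearMap.inr ℝ _ _)) x :=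
    fun x => rfl
  simp only [h]
  rw [← map_sum, sum_coordIncl]

theorem exists_hasFDerivAt_bilin_sub {X V P : Type*} [NormedAddCommGroup X] [NormedSpace ℝ X]
    [NormedAddCommGroup V] [NormedSpace ℝ V] [NormedAddCommGroup P] [NormedSpace ℝ P]
    (b : P →L[ℝ] V →L[ℝ] ℝ) {G : X × V → ℝ} {G' : (X × V) →L[ℝ] ℝ} {x : X} {u : V} (p : P)
    (hG : HasFDerivAt G G' (x, u)) :
    ∃ T : (X × V × P) →L[ℝ] ℝ,
      HasFDerivAt (fun y : X × V × P => b y.2.2 y.2.1 - G (y.1, y.2.1)) T (x, (u, p)) ∧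
      ∀ Y, T Y = b p Y.2.1 + b Y.2.2 u - G' (Y.1, Y.2.1) := by
  let cp : (X × V × P) →L[ℝ] P :=
    (ContinuousLinearMap.snd ℝ V P).comp (ContinuousLinearMap.snd ℝ X (V × P))
  let cu : (X × V × P) →L[ℝ] V :=
    (ContinuousLinearMap.fst ℝ V P).comp (ContinuousLinearMap.snd ℝ X (V × P))
  let cv : (X × V × P) →L[ℝ] X × V := (ContinuousLinearMap.fst ℝ X (V × P)).prod cu
  have h1 : HasFDerivAt (fun y => b (cp y)) (b.comp cp) (x, (u, p)) :=
    (b.comp cp).hasFDerivAt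
  have h2 := h1.clm_apply (cu.hasFDerivAt (x := (x, (u, p))))
  have h3 : HasFDerivAt (fun y => G (cv y)) (G'.comp cv) (x, (u, p)) :=
    HasFDerivAt.comp (x, (u, p)) (f := cv) hG cv.hasFDerivAt
  exact ⟨_, h2.sub h3, fun Y => rfl⟩

/-- In natural coordinates `H = p_i^A v^i_A - L`. -/
theorem exists_hasMFDerivAt_hamiltonian (w : VelCovel k n Q) :
    ∃ T : (EuclideanSpace ℝ (Fin n) × VelModel k n × CovelModel k n) →L[ℝ] ℝ,
      HasMFDerivAt (IVelCovel k n) 𝓘(ℝ) (hamiltonian L) w T ∧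
      ∀ Y, T Y = pairing k n w.snd.2 Y.2.1 + pairing k n Y.2.2 w.snd.1 -
        dLag L (pr1 w) (Y.1, Y.2.1) := by
  obtain ⟨q, u, p⟩ := w
  change VelModel k n at u
  change CovelModel k n at p
  let w : VelCovel k n Q := ⟨q, u, p⟩
  have hx : extChartAt (IVelCovel k n) w w = (extChartAt (𝓡 n) q q, (u, p)) :=
    extChartAt_velCovel_self _
  have hl : HasFDerivAt (localLagrangian L ⟨q, u⟩) (dLag L ⟨q, u⟩) (extChartAt (𝓡 n) q q, u) := by
    have := hasFDerivAt_localLagrangian L ⟨q, u⟩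
    rwa [extChartAt_vel_self] at this
  obtain ⟨T, hT, hTY⟩ := exists_hasFDerivAt_bilin_sub (pairing k n) p hl
  rw [← hx] at hT
  refine ⟨T, hasMFDerivAt_real_of_eventually (p := w) hT ?_, hTY⟩
  filter_upwards [eventually_mem_target (J := IVelCovel k n) w] with y hy
  obtain ⟨hs, h1, h2, h3⟩ := velCovel_symm_spec hy rfl
  refine congrArg₂ (· - ·) ?_ ?_
  · rw [← h2, ← h3, pairing_apply]
    refine Finset.sum_congr rfl fun A _ => ?_
    refine congrArg (fun e => (((extChartAt (IVelCovel k n) w).symm y).snd.2 : CovelModel k n) e A)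
      ?_
    exact (tanCoordSymm_tanCoord hs _).symm
  · rw [lagrangian_eq_localLagrangian L (v₀ := ⟨q, u⟩) hs, extChartAt_vel]
    exact congrArg (localLagrangian L ⟨q, u⟩) (Prod.ext h1 h2)

theorem legendre_snd (v : Vel k n Q) :
    ((legendre L v).snd : CovelModel k n) = verticalPart k n (dLag L v) := by
  refine ContinuousLinearMap.ext fun e => funext fun A => ?_
  refine Eq.trans ?_ (verticalPart_apply (dLag L v) e A).symm
  refine (fiberDeriv_eq L (mem_chart_source _ v.proj) (coordIncl A e)).trans ?_
  rw [tanCoord_self]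
  rfl

/-- The differential of the Hamiltonian at a point of `M_L`: as the momenta are `∂L/∂v`, its component
along `dv` vanishes. -/
theorem differential_hamiltonian (v : Vel k n Q)
    (Y : EuclideanSpace ℝ (Fin n) × VelModel k n × CovelModel k n) :
    differential (IVelCovel k n) (hamiltonian L) (inclML L ((pr1ML L).symm v)) Y =
      pairing k n Y.2.2 (v.snd : VelModel k n) - dLag L v (Y.1, 0) := by
  obtain ⟨T, hT, hTY⟩ := exists_hasMFDerivAt_hamiltonian L (inclML L ((pr1ML L).symm v))
  have h := congrArg (fun T : (EuclideanSpace ℝ (Fin n) × VelModel k n × CovelModel k n) →L[ℝ] ℝ =>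
    T Y) hT.mfderiv
  have h2 : dLag L v (Y.1, Y.2.1) = dLag L v (Y.1, 0) + dLag L v (0, Y.2.1) := by
    rw [← map_add]; simp
  have h3 := pairing_verticalPart (dLag L v) Y.2.1
  rw [← legendre_snd] at h3
  refine (h.trans (hTY Y)).trans ?_
  change pairing k n ((legendre L v).snd : CovelModel k n) Y.2.1 +
    pairing k n Y.2.2 (v.snd : VelModel k n) - dLag L v (Y.1, Y.2.1) = _
  rw [h2, h3]
  ring

theorem differential_hamiltonian_inclML (v : Vel k n Q)
    (Y : EuclideanSpace ℝ (Fin n) × VelModel k n) :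
    differential (IVel k n) (fun m' => hamiltonian L (inclML L m')) ((pr1ML L).symm v) Y =
      d2Lag L v Y (0, (v.snd : VelModel k n)) - dLag L v (Y.1, 0) := by
  obtain ⟨T, hT, -⟩ := exists_hasMFDerivAt_hamiltonian L (inclML L ((pr1ML L).symm v))
  have h := (hT.mdifferentiableAt.hasMFDerivAt.comp _ (hasMFDerivAt_inclML L v)).mfderiv
  have h1 := congrArg (fun T : (EuclideanSpace ℝ (Fin n) × VelModel k n) →L[ℝ] ℝ => T Y) h
  refine h1.trans ?_
  refine (differential_hamiltonian L v (Y.1, (Y.2, verticalPart k n (d2Lag L v Y)))).trans ?_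
  exact congrArg (· - dLag L v (Y.1, 0)) (pairing_verticalPart (d2Lag L v Y) v.snd)

end Local

/-! ### Linear algebra of the field equations at a point -/

section Pointwise

variable {k n : ℕ}

/-- The Lagrangian equation at the point `u` of the fibre, in natural coordinates: `D₁` and `D₂` stand
for the first two differentials of the local Lagrangian, `z A` for the components of the `k`-vector. -/
def LagrangianAt (D₁ : (EuclideanSpace ℝ (Fin n) × VelModel k n) →L[ℝ] ℝ)
    (D₂ : (EuclideanSpace ℝ (Fin n) × VelModel k n) →L[ℝ]
      (EuclideanSpace ℝ (Fin n) × VelModel k n) →L[ℝ] ℝ)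
    (u : VelModel k n) (z : Fin k → EuclideanSpace ℝ (Fin n) × VelModel k n) : Prop :=
  ∀ Y : EuclideanSpace ℝ (Fin n) × VelModel k n,
    ∑ A, (D₂ Y (0, coordIncl A (z A).1) - D₂ (z A) (0, coordIncl A Y.1)) =
      D₂ Y (0, u) - D₁ (Y.1, 0)

/-- The Euler-Lagrange equations at a point, in natural coordinates: the `dq^i`-component of the field
equations once the second order condition is granted. -/
def EulerLagrangeAt (D₁ : (EuclideanSpace ℝ (Fin n) × VelModel k n) →L[ℝ] ℝ)
    (D₂ : (EuclideanSpace ℝ (Fin n) × VelModel k n) →L[ℝ]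
      (EuclideanSpace ℝ (Fin n) × VelModel k n) →L[ℝ] ℝ)
    (z : Fin k → EuclideanSpace ℝ (Fin n) × VelModel k n) : Prop :=
  ∀ x : EuclideanSpace ℝ (Fin n), ∑ A, D₂ (z A) (0, coordIncl A x) = D₁ (x, 0)

variable {D₁ : (EuclideanSpace ℝ (Fin n) × VelModel k n) →L[ℝ] ℝ}
  {D₂ : (EuclideanSpace ℝ (Fin n) × VelModel k n) →L[ℝ]
    (EuclideanSpace ℝ (Fin n) × VelModel k n) →L[ℝ] ℝ}
  {u : VelModel k n} {z : Fin k → EuclideanSpace ℝ (Fin n) × VelModel k n}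

theorem sum_apply_coordIncl (f : (EuclideanSpace ℝ (Fin n) × VelModel k n) →L[ℝ] ℝ)
    (e : Fin k → EuclideanSpace ℝ (Fin n)) :
    ∑ A, f (0, coordIncl A (e A)) = f (0, ∑ A, coordIncl A (e A)) :=
  (map_sum (f.comp (ContinuousLinearMap.inr ℝ _ _)) (fun A => coordIncl A (e A)) _).symm

/-- Under the second order condition, the terms of the Lagrangian equation involving `D₂ Y` cancel. -/
theorem lagrangianAt_iff_eulerLagrangeAt (hz : ∀ A, (z A).1 = u (Pi.single A 1 : Fin k → ℝ)) :
    LagrangianAt D₁ D₂ u z ↔ EulerLagrangeAt D₁ D₂ z := by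
  have h : ∀ Y : EuclideanSpace ℝ (Fin n) × VelModel k n,
      ∑ A, D₂ Y (0, coordIncl A (z A).1) = D₂ Y (0, u) := by
    intro Y
    rw [sum_apply_coordIncl]
    simp only [hz, sum_coordIncl]
  simp only [LagrangianAt, EulerLagrangeAt, Finset.sum_sub_distrib, h, sub_right_inj]
  exact ⟨fun H x => H (x, 0), fun H Y => H Y.1⟩

/-- The unified equation at a point of `M_L`, tested on all tangent vectors `Y` of the Whitney sum,
consists of the second order condition (its momentum component) and the Euler-Lagrange equations. -/
theorem unifiedAt_iff :
    (∀ Y : EuclideanSpace ℝ (Fin n) × VelModel k n × CovelModel k n,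
      ∑ A, (Y.2.2 (z A).1 A - D₂ (z A) (0, coordIncl A Y.1)) =
        pairing k n Y.2.2 u - D₁ (Y.1, 0)) ↔
      (∀ A, (z A).1 = u (Pi.single A 1 : Fin k → ℝ)) ∧ EulerLagrangeAt D₁ D₂ z := by
  simp only [pairing_apply, Finset.sum_sub_distrib]
  constructor
  · intro H
    refine ⟨fun B => ?_, fun x => ?_⟩
    · ext i
      -- test with the covelocity `dq^i` in the `B`-th place
      let p : CovelModel k n := (ContinuousLinearMap.single ℝ (fun _ : Fin k => ℝ) B).comp
        (EuclideanSpace.proj i)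
      have hp : ∀ e A, p e A = (Pi.single B (e i) : Fin k → ℝ) A := fun e A => rfl
      have h := H (0, (0, p))
      simpa [hp, Pi.single_apply, Prod.mk_zero_zero] using h
    · simpa using H (x, (0, 0))
  · rintro ⟨hz, hE⟩ Y
    simp only [hz, hE Y.1]

/-- The matrix of `D₂` on vertical vectors, in the fibre coordinates `v^i_A`. -/
noncomputable def fiberHessian (D₂ : (EuclideanSpace ℝ (Fin n) × VelModel k n) →L[ℝ]
    (EuclideanSpace ℝ (Fin n) × VelModel k n) →L[ℝ] ℝ) :
    Matrix (Fin n × Fin k) (Fin n × Fin k) ℝ :=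
  Matrix.of fun a b => D₂ (0, coordIncl a.2 (EuclideanSpace.single a.1 1))
    (0, coordIncl b.2 (EuclideanSpace.single b.1 1))

theorem eq_sum_coordIncl_single (e : Fin k → EuclideanSpace ℝ (Fin n)) :
    ∑ A, coordIncl A (e A) = ∑ b : Fin n × Fin k,
      (e b.2 b.1) • coordIncl b.2 (EuclideanSpace.single b.1 1) := by
  rw [Fintype.sum_prod_type_right]
  refine Finset.sum_congr rfl fun A _ => ?_
  have h : e A = ∑ i, e A i • EuclideanSpace.single i (1 : ℝ) := by
    ext j
    simp [Finset.sum_apply, Pi.single_apply]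
  conv_lhs => rw [h, map_sum]
  simp only [map_smul]

/-- If the Hessian is nondegenerate, the component of the Lagrangian equation along the fibre is the
second order condition. -/
theorem LagrangianAt.sopde (hdet : (fiberHessian D₂).det ≠ 0) (H : LagrangianAt D₁ D₂ u z)
    (A : Fin k) :
    (z A).1 = u (Pi.single A 1 : Fin k → ℝ) := by
  -- the tuple `e` lies in the kernel of the Hessian
  let e : Fin k → EuclideanSpace ℝ (Fin n) := fun A => (z A).1 - u (Pi.single A 1 : Fin k → ℝ)
  have h : ∀ w : VelModel k n, D₂ (0, w) (0, ∑ A, coordIncl A (e A)) = 0 := by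
    intro w
    have h1 := H (0, w)
    simp only [map_zero, Prod.mk_zero_zero, sub_zero] at h1
    rw [← sum_apply_coordIncl]
    have h2 : D₂ (0, w) (0, u) = ∑ A, D₂ (0, w) (0, coordIncl A (u (Pi.single A 1 : Fin k → ℝ))) := by
      rw [sum_apply_coordIncl (e := fun A => u (Pi.single A 1 : Fin k → ℝ)), sum_coordIncl]
    rw [h2, ← sub_eq_zero, ← Finset.sum_sub_distrib] at h1
    rw [← h1]
    refine Finset.sum_congr rfl fun A _ => ?_
    rw [← map_sub, Prod.mk_sub_mk, ← map_sub, sub_zero]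
  have hM : (fiberHessian D₂).mulVec (fun b => e b.2 b.1) = 0 := by
    funext a
    refine Eq.trans ?_ (h (coordIncl a.2 (EuclideanSpace.single a.1 1)))
    rw [eq_sum_coordIncl_single]
    let f := (D₂ (0, coordIncl a.2 (EuclideanSpace.single a.1 1))).comp
      (ContinuousLinearMap.inr ℝ (EuclideanSpace ℝ (Fin n)) (VelModel k n))
    change _ = f (∑ b : Fin n × Fin k, e b.2 b.1 • coordIncl b.2 (EuclideanSpace.single b.1 1))
    rw [map_sum]
    refine Finset.sum_congr rfl fun b _ => ?_
    rw [map_smul, smul_eq_mul, mul_comm]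
    rfl
  have h0 := Matrix.eq_zero_of_mulVec_eq_zero hdet hM
  rw [← sub_eq_zero]
  ext i
  exact congrFun h0 (i, A)

end Pointwise

/-! ### The field equations in natural coordinates -/

section Equations

variable {k n : ℕ} {Q : Type*} [TopologicalSpace Q] [ChartedSpace (EuclideanSpace ℝ (Fin n)) Q]
  [IsManifold (𝓡 n) ∞ Q] (L : Lagrangian k n Q)

theorem mfderiv_proj (v : Vel k n Q) (Y : EuclideanSpace ℝ (Fin n) × VelModel k n) :
    mfderiv (IVel k n) (𝓡 n) (TotalSpace.proj : Vel k n Q → Q) v Y = Y.1 := by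
  have h : HasMFDerivAt (IVel k n) (𝓡 n) (TotalSpace.proj : Vel k n Q → Q) v
      (ContinuousLinearMap.fst ℝ (EuclideanSpace ℝ (Fin n)) (VelModel k n)) := by
    refine hasMFDerivAt_of_eventually_extChartAt (contMDiffAt_proj (VelFiber k n Q)
      (n := ∞) (IB := 𝓡 n)).continuousAt hasFDerivAt_fst ?_
    filter_upwards [eventually_mem_target (J := IVel k n) v] with y hy
    exact (vel_symm_spec hy rfl).2.1
  exact congrArg (fun T : (EuclideanSpace ℝ (Fin n) × VelModel k n) →L[ℝ]
    EuclideanSpace ℝ (Fin n) => T Y) h.mfderiv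

theorem isSopde_iff (X : Fin k → ∀ v : Vel k n Q, TangentSpace (IVel k n) v) :
    IsSopde X ↔ ∀ (v : Vel k n Q) (A : Fin k),
      (X A v : EuclideanSpace ℝ (Fin n) × VelModel k n).1 =
        (v.snd : VelModel k n) (Pi.single A 1 : Fin k → ℝ) :=
  ⟨fun h v A => (mfderiv_proj v (X A v)).symm.trans (h A v),
    fun h A v => (mfderiv_proj v (X A v)).trans (h v A)⟩

theorem solvesLagrangian_iff (X : Fin k → ∀ v : Vel k n Q, TangentSpace (IVel k n) v) :
    SolvesLagrangian L X ↔ ∀ v : Vel k n Q,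
      LagrangianAt (dLag L v) (d2Lag L v) v.snd (fun A => X A v) :=
  forall_congr' fun v => forall_congr' fun Y => by
    refine Iff.of_eq (congrArg₂ _ ?_ (differential_energy L v Y))
    exact Finset.sum_congr rfl fun A _ => omegaL_eq L A v (X A v) Y

theorem solvesUnified_iff (Z : Fin k → ∀ m : ML L, TangentSpace (IVel k n) m) :
    SolvesUnified L Z ↔ ∀ v : Vel k n Q,
      (∀ A, (Z A ((pr1ML L).symm v) : EuclideanSpace ℝ (Fin n) × VelModel k n).1 =
        (v.snd : VelModel k n) (Pi.single A 1 : Fin k → ℝ)) ∧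
      EulerLagrangeAt (dLag L v) (d2Lag L v) (fun A => Z A ((pr1ML L).symm v)) := by
  rw [SolvesUnified, (pr1ML L).symm.surjective.forall]
  refine forall_congr' fun v => ?_
  refine Iff.trans (forall_congr' fun Y => ?_) unifiedAt_iff
  refine Iff.of_eq (congrArg₂ _ ?_ (differential_hamiltonian L v Y))
  refine Finset.sum_congr rfl fun A _ => ?_
  refine (congrArg (fun T => Omega A (inclML L ((pr1ML L).symm v)) T Y)
    (mfderiv_inclML L v (Z A ((pr1ML L).symm v)))).trans ?_
  refine (Omega_eq A (inclML L ((pr1ML L).symm v)) _ Y).trans ?_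
  exact congrArg (Y.2.2 _ A - ·) (verticalPart_apply _ _ _)

theorem solvesUnifiedOnML_iff (Z : Fin k → ∀ m : ML L, TangentSpace (IVel k n) m) :
    SolvesUnifiedOnML L Z ↔ ∀ v : Vel k n Q,
      LagrangianAt (dLag L v) (d2Lag L v) v.snd (fun A => Z A ((pr1ML L).symm v)) := by
  rw [SolvesUnifiedOnML, (pr1ML L).symm.surjective.forall]
  refine forall_congr' fun v => forall_congr' fun Y => ?_
  refine Iff.of_eq (congrArg₂ _ ?_ (differential_hamiltonian_inclML L v Y))
  refine Finset.sum_congr rfl fun A _ => ?_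
  refine (congrArg₂ (Omega A (inclML L ((pr1ML L).symm v)))
    (mfderiv_inclML L v (Z A ((pr1ML L).symm v))) (mfderiv_inclML L v Y)).trans ?_
  refine (Omega_eq A (inclML L ((pr1ML L).symm v)) _ _).trans ?_
  exact congrArg₂ (· - ·) (verticalPart_apply _ _ _) (verticalPart_apply _ _ _)

theorem IsRegularLagrangian.det_fiberHessian_ne_zero (hL : IsRegularLagrangian L) (v : Vel k n Q) :
    (fiberHessian (d2Lag L v)).det ≠ 0 := by
  have h := hL v
  obtain ⟨q, x⟩ := v
  change VelModel k n at x
  let x₀ := extChartAt (𝓡 n) q q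
  let i := ContinuousLinearMap.inr ℝ (EuclideanSpace ℝ (Fin n)) (VelModel k n)
  have h1 : fderiv ℝ (fun u : VelModel k n => L (fiberIncl q u)) =
      fun u => precompForm i (fderiv ℝ (localLagrangian L ⟨q, x⟩) (x₀, u)) := by
    funext u
    ext w
    refine (fiberDeriv_eq L (v₀ := ⟨q, x⟩) (v := ⟨q, u⟩) (mem_chart_source _ q) w).trans ?_
    have hu : extChartAt (IVel k n) (⟨q, x⟩ : Vel k n Q) ⟨q, u⟩ = (x₀, u) :=
      extChartAt_vel_self (⟨q, u⟩ : Vel k n Q)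
    rw [hu, tanCoord_self]
    rfl
  have h2 : HasFDerivAt (fderiv ℝ (localLagrangian L ⟨q, x⟩)) (d2Lag L ⟨q, x⟩) (x₀, x) := by
    have := hasFDerivAt_fderiv_localLagrangian L ⟨q, x⟩
    rwa [extChartAt_vel_self] at this
  have h3 : HasFDerivAt (fun u : VelModel k n => (x₀, u)) i x := hasFDerivAt_prodMk_right x₀ x
  have h4 : HasFDerivAt (fderiv ℝ (fun u : VelModel k n => L (fiberIncl q u)))
      ((precompForm i).comp ((d2Lag L ⟨q, x⟩).comp i)) x := by
    rw [h1]
    exact (precompForm i).hasFDerivAt.comp x (h2.comp x h3)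
  have h5 : fiberHessian (d2Lag L ⟨q, x⟩) = Matrix.of fun a b : Fin n × Fin k =>
      fderiv ℝ (fderiv ℝ (fun u : VelModel k n => L (fiberIncl q u))) x
        (coordIncl a.2 (EuclideanSpace.single a.1 1))
        (coordIncl b.2 (EuclideanSpace.single b.1 1)) := by
    rw [h4.fderiv]
    rfl
  rw [h5]
  exact h

end Equations

/-! ### Transport along the diffeomorphism between `M_L` and the velocity bundle -/

section Transport

/-- A smooth map relating two `k`-vector fields sends integral sections to integral sections. -/
theorem IsIntegralSection.comp {E H M E' H' M' : Type*} [NormedAddCommGroup E] [NormedSpace ℝ E]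
    [TopologicalSpace H] {J : ModelWithCorners ℝ E H} [TopologicalSpace M] [ChartedSpace H M]
    [NormedAddCommGroup E'] [NormedSpace ℝ E'] [TopologicalSpace H']
    {J' : ModelWithCorners ℝ E' H'} [TopologicalSpace M'] [ChartedSpace H' M'] {k : ℕ}
    {X : Fin k → ∀ p : M, TangentSpace J p} {Y : Fin k → ∀ p : M', TangentSpace J' p}
    {F : M → M'} (hF : ContMDiff J J' ∞ F)
    (hXY : ∀ A p, mfderiv J J' F p (X A p) = Y A (F p)) {U : Set (Fin k → ℝ)}
    {φ : (Fin k → ℝ) → M} (h : IsIntegralSection J X U φ) :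
    IsIntegralSection J' Y U (F ∘ φ) := by
  obtain ⟨hU, h0, hφ, hd⟩ := h
  refine ⟨hU, h0, hF.comp_contMDiffOn hφ, fun t ht A => ?_⟩
  have h1 : MDifferentiableAt 𝓘(ℝ, Fin k → ℝ) J φ t :=
    (hφ.contMDiffAt (hU.mem_nhds ht)).mdifferentiableAt (by simp)
  have h2 : MDifferentiableAt J J' F (φ t) := hF.contMDiffAt.mdifferentiableAt (by simp)
  rw [mfderiv_comp t h2 h1]
  exact (congrArg (mfderiv J J' F (φ t)) (hd t ht A)).trans (hXY A (φ t))

variable {k n : ℕ} {Q : Type*} [TopologicalSpace Q] [ChartedSpace (EuclideanSpace ℝ (Fin n)) Q]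
  [IsManifold (𝓡 n) ∞ Q] (L : Lagrangian k n Q)

theorem contMDiff_pr1ML : ContMDiff (IVel k n) (IVel k n) ∞ (pr1ML L) := by
  intro m
  refine (contMDiffAt_iff_target).2 ⟨(pr1ML L).continuous.continuousAt, ?_⟩
  exact contMDiffAt_extChartAt (x := m)

theorem contMDiff_pr1ML_symm : ContMDiff (IVel k n) (IVel k n) ∞ (pr1ML L).symm := by
  intro v
  refine (contMDiffAt_iff_target).2 ⟨(pr1ML L).symm.continuous.continuousAt, ?_⟩
  exact contMDiffAt_extChartAt (x := v)

theorem mfderiv_pr1ML_symm (v : Vel k n Q) (Y : EuclideanSpace ℝ (Fin n) × VelModel k n) :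
    mfderiv (IVel k n) (IVel k n) (pr1ML L).symm v Y = Y := by
  have h : HasMFDerivAt (IVel k n) (IVel k n) (pr1ML L).symm v
      (ContinuousLinearMap.id ℝ (EuclideanSpace ℝ (Fin n) × VelModel k n)) := by
    refine hasMFDerivAt_of_eventually_extChartAt (pr1ML L).symm.continuous.continuousAt
      (hasFDerivAt_id _) ?_
    filter_upwards [eventually_mem_target (J := IVel k n) v] with y hy
    exact (extChartAt (IVel k n) v).right_inv hy
  exact congrArg (fun T : (EuclideanSpace ℝ (Fin n) × VelModel k n) →L[ℝ]
    EuclideanSpace ℝ (Fin n) × VelModel k n => T Y) h.mfderiv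

theorem isKVectorField_pushforward {Z : Fin k → ∀ m : ML L, TangentSpace (IVel k n) m}
    (hZ : IsKVectorField (IVel k n) Z) : IsKVectorField (IVel k n) (pushforward L Z) := fun A =>
  ((contMDiff_pr1ML L).contMDiff_tangentMap (m := ∞) (by simp)).comp
    ((hZ A).comp (contMDiff_pr1ML_symm L))

/-- The lift to `M_L` of a `k`-vector field on `T¹ₖQ`; the chart of `M_L` at `m` being that of `T¹ₖQ`
at its projection, corresponding tangent vectors have the same coordinates. -/
noncomputable def liftML (X : Fin k → ∀ v : Vel k n Q, TangentSpace (IVel k n) v) :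
    Fin k → ∀ m : ML L, TangentSpace (IVel k n) m :=
  fun A m => (X A (pr1ML L m) : EuclideanSpace ℝ (Fin n) × VelModel k n)

theorem pushforward_liftML (X : Fin k → ∀ v : Vel k n Q, TangentSpace (IVel k n) v) :
    pushforward L (liftML L X) = X :=
  funext fun A => funext fun v => pushforward_eq L (liftML L X) A v

theorem isKVectorField_liftML {X : Fin k → ∀ v : Vel k n Q, TangentSpace (IVel k n) v}
    (hX : IsKVectorField (IVel k n) X) : IsKVectorField (IVel k n) (liftML L X) := by
  intro A
  have h := ((contMDiff_pr1ML_symm L).contMDiff_tangentMap (m := ∞) (by simp)).comp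
    ((hX A).comp (contMDiff_pr1ML L))
  refine h.congr fun m => ?_
  obtain ⟨v, rfl⟩ := (pr1ML L).symm.surjective m
  exact congrArg (fun Y : EuclideanSpace ℝ (Fin n) × VelModel k n =>
    (⟨(pr1ML L).symm v, Y⟩ : TangentBundle (IVel k n) (ML L))) (mfderiv_pr1ML_symm L v (X A v)).symm

theorem isIntegrable_pushforward_iff (Z : Fin k → ∀ m : ML L, TangentSpace (IVel k n) m) :
    IsIntegrable (IVel k n) (pushforward L Z) ↔ IsIntegrable (IVel k n) Z := by
  constructor
  · intro h m
    obtain ⟨U, φ, hφ, h0⟩ := h (pr1ML L m)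
    refine ⟨U, _, hφ.comp (contMDiff_pr1ML_symm L) fun A v => ?_, ?_⟩
    · exact (mfderiv_pr1ML_symm L v _).trans (pushforward_eq L Z A v)
    · exact (congrArg (pr1ML L).symm h0).trans ((pr1ML L).symm_apply_apply m)
  · intro h v
    obtain ⟨U, φ, hφ, h0⟩ := h ((pr1ML L).symm v)
    refine ⟨U, _, hφ.comp (contMDiff_pr1ML L) fun A m => ?_, ?_⟩
    · obtain ⟨v, rfl⟩ := (pr1ML L).symm.surjective m
      rfl
    · exact congrArg (pr1ML L) h0

end Transport

/-! ### The correspondence of solutions -/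

section Correspondence

variable {k n : ℕ} {Q : Type*} [TopologicalSpace Q] [ChartedSpace (EuclideanSpace ℝ (Fin n)) Q]
  [IsManifold (𝓡 n) ∞ Q] (L : Lagrangian k n Q)

/-- The pulled-back equation and the Lagrangian equation have the same expression `LagrangianAt` in
natural coordinates. -/
theorem solvesUnifiedOnML_iff_pushforward (Z : Fin k → ∀ m : ML L, TangentSpace (IVel k n) m) :
    SolvesUnifiedOnML L Z ↔ SolvesLagrangian L (pushforward L Z) := by
  rw [solvesUnifiedOnML_iff, solvesLagrangian_iff]
  refine forall_congr' fun v => Iff.of_eq ?_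
  exact congrArg (LagrangianAt (dLag L v) (d2Lag L v) v.snd)
    (funext fun A => (pushforward_eq L Z A v).symm)

/-- The unified equation for `Z` says that its projection is a second order solution of the Lagrangian
equation. -/
theorem solvesUnified_iff_pushforward (Z : Fin k → ∀ m : ML L, TangentSpace (IVel k n) m) :
    SolvesUnified L Z ↔ IsSopde (pushforward L Z) ∧ SolvesLagrangian L (pushforward L Z) := by
  rw [solvesUnified_iff, ← solvesUnifiedOnML_iff_pushforward, solvesUnifiedOnML_iff, isSopde_iff,
    ← forall_and]
  refine forall_congr' fun v => ?_
  have h : ∀ A, pushforward L Z A v = Z A ((pr1ML L).symm v) := fun A => pushforward_eq L Z A v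
  simp only [h]
  exact and_congr_right fun hz => (lagrangianAt_iff_eulerLagrangeAt hz).symm

theorem IsRegularLagrangian.isSopde (hL : IsRegularLagrangian L)
    {X : Fin k → ∀ v : Vel k n Q, TangentSpace (IVel k n) v} (hX : SolvesLagrangian L X) :
    IsSopde X :=
  (isSopde_iff X).2 fun v A =>
    ((solvesLagrangian_iff L X).1 hX v).sopde (hL.det_fiberHessian_ne_zero L v) A

end Correspondence

end KSymplectic

theorem mainTheorem2 {k n : ℕ} {Q : Type*} [TopologicalSpace Q]
    [ChartedSpace (EuclideanSpace ℝ (Fin n)) Q] [IsManifold (𝓡 n) ∞ Q]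
    (L : Lagrangian k n Q) :
    -- solutions of the unified equation project to solutions of the Lagrangian equation
    (∀ Z : Fin k → ∀ m : ML L, TangentSpace (IVel k n) m,
      IsKVectorField (IVel k n) Z → SolvesUnified L Z →
        IsKVectorField (IVel k n) (pushforward L Z) ∧ SolvesLagrangian L (pushforward L Z)) ∧
    -- the converse
    (∀ X : Fin k → ∀ v : Vel k n Q, TangentSpace (IVel k n) v,
      IsKVectorField (IVel k n) X → SolvesLagrangian L X → (IsRegularLagrangian L ∨ IsSopde X) →
        ∃ Z : Fin k → ∀ m : ML L, TangentSpace (IVel k n) m,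
          IsKVectorField (IVel k n) Z ∧ SolvesUnified L Z ∧ pushforward L Z = X) ∧
    -- integrability of Z against holonomy of X_L
    (∀ Z : Fin k → ∀ m : ML L, TangentSpace (IVel k n) m,
      IsKVectorField (IVel k n) Z → SolvesUnified L Z →
        (IsIntegrable (IVel k n) Z ↔ IsHolonomic (pushforward L Z))) ∧
    -- the same correspondence for the equation pulled back to M_L, for every L
    (∀ Z : Fin k → ∀ m : ML L, TangentSpace (IVel k n) m,
      IsKVectorField (IVel k n) Z →
        (SolvesUnifiedOnML L Z ↔ SolvesLagrangian L (pushforward L Z))) ∧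
    (∀ X : Fin k → ∀ v : Vel k n Q, TangentSpace (IVel k n) v,
      IsKVectorField (IVel k n) X → SolvesLagrangian L X →
        ∃ Z : Fin k → ∀ m : ML L, TangentSpace (IVel k n) m,
          IsKVectorField (IVel k n) Z ∧ SolvesUnifiedOnML L Z ∧ pushforward L Z = X) ∧
    -- for regular L the two forms of the unified equation agree
    (IsRegularLagrangian L → ∀ Z : Fin k → ∀ m : ML L, TangentSpace (IVel k n) m,
      IsKVectorField (IVel k n) Z → (SolvesUnified L Z ↔ SolvesUnifiedOnML L Z)) := by
  refine ⟨fun Z hZ h => ⟨isKVectorField_pushforward L hZ, ((solvesUnified_iff_pushforward L Z).1 h).2⟩,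
    fun X hX h hX' => ?_, fun Z _ h => ?_, fun Z _ => solvesUnifiedOnML_iff_pushforward L Z,
    fun X hX h => ?_, fun hL Z _ => ?_⟩
  · refine ⟨liftML L X, isKVectorField_liftML L hX, ?_, pushforward_liftML L X⟩
    rw [solvesUnified_iff_pushforward, pushforward_liftML]
    exact ⟨hX'.elim (fun hL => hL.isSopde L h) id, h⟩
  · rw [IsHolonomic, isIntegrable_pushforward_iff]
    exact ⟨fun hZ => ⟨((solvesUnified_iff_pushforward L Z).1 h).1, hZ⟩, fun hZ => hZ.2⟩
  · refine ⟨liftML L X, isKVectorField_liftML L hX, ?_, pushforward_liftML L X⟩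
    rwa [solvesUnifiedOnML_iff_pushforward, pushforward_liftML]
  · rw [solvesUnified_iff_pushforward, solvesUnifiedOnML_iff_pushforward]
    exact ⟨And.right, fun h => ⟨hL.isSopde L h, h⟩⟩
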